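/- **Setting.** Let $\mathrm{VARS}$ be an infinite set of variables. Terms are built from variables, integer numerals and function symbols; a constant is a numeral or a nullary function symbol. Built-in constraints are finite conjunctions of atoms ($\top$ is the empty one): $\bot$, syntactic equalities $s\doteq t$, equations between arithmetic expressions built from variables and integers with $+$ and $-$, and further built-in predicates. Let $\mathcal{CT}$ be a complete constraint theory: the theory of a structure in which $\doteq$ obeys Clark's equality theory, the numerals are the integers with their $+$ and $-$ (an arithmetic equation holds only if its variables denote integers), and the other predicates are arbitrary. A *CHR state* is a triple $\langle\mathbb G;\mathbb B;\mathbb V\rangle$ of a finite multiset of user-defined constraints, a conjunction of built-in constraints, and a finite set of (global) variables. *State equivalence* $\equiv$ is the smallest equivalence relation with 1. $\langle\mathbb G;x\doteq t\wedge\mathbb B;\mathbb V\rangle\equiv\langle\mathbb G[x/t];x\doteq t\wedge\mathbb B;\mathbb V\rangle$; 2. $\langle\mathbb G;\mathbb B;\mathbb V\rangle\equiv\langle\mathbb G;\mathbb B';\mathbb V\rangle$ if $\mathcal{CT}\models\exists\bar s.\mathbb B\leftrightarrow\exists\bar s'.\mathbb B'$, where $\bar s,\bar s'$ are the variables of $\mathbb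 B$, $\mathbb B'$ that are neither in $\mathbb V$ nor occur in $\mathbb G$; 3. $\langle\mathbb G;\mathbb B;\{X\}\cup\mathbb V\rangle\equiv\langle\mathbb G;\mathbb B;\mathbb V\rangle$ if $X$ occurs in neither $\mathbb G$ nor $\mathbb B$; 4. $\langle\mathbb G;\bot;\mathbb V\rangle\equiv\langle\mathbb G';\bot;\mathbb V\rangle$. For a program $\mathcal P$ (a set of CHR rules), $\sigma\rightarrowtail\tau$ holds if, for a copy $H_1\backslash H_2\Leftrightarrow D\mid B_c,B_b$ of a rule of $\mathcal P$ with fresh variables, $\sigma\equiv\langle H_1\uplus H_2\uplus\mathbb G;D\wedge\mathbb B;\mathbb V\rangle$ and $\tau\equiv\langle H_1\uplus B_c\uplus\mathbb G;D\wedge B_b\wedge\mathbb B;\mathbb V\rangle$. Fresh means: no variable of the copy is in $\mathbb V$, and those not occurring in the head $H_1\uplus H_2$ do not occur in $\mathbb G$ or $\mathbb B$. A *GTS* consists of a finite type graph $TG$ and a set of rules $L\leftarrow K\rightarrow R$ of finite graphs typed over $TG$ with type-preserving inclusions. The constraint symbols are $v/2$ for nodes $v$ and $e/3$ for edges $e$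 of $TG$. Elements $x$ are assigned pairwise distinct variables $\mathrm{var}(x)$ and $\mathrm{dvar}(x)$. For a graph $G$ typed over $TG$, a node $v$ has the encodings $\mathtt{chr}_G(\mathrm{gnd},v)=\mathrm{type}(v)(\mathrm{var}(v),\deg_G(v))$ and $\mathtt{chr}_G(\mathrm{kp},v)=\mathrm{type}(v)(\mathrm{var}(v),\mathrm{dvar}(v))$ (a loop counts twice in $\deg_G$); an edge $e$ has, in both cases, the encoding $\mathrm{type}(e)(\mathrm{var}(e),\mathrm{var}(\mathrm{src}(e)),\mathrm{var}(\mathrm{tgt}(e)))$. Put $\mathtt{chr}(\mathrm{gnd},G)=\{\mathtt{chr}_G(\mathrm{gnd},x)\mid x\in G\}$. The *GTS-CHR program* of the GTS consists of one rule $C_L\Leftrightarrow C_R^u,C_R^b$ for each of its rules, where, with a new copy $v'$ (of the same type) of each $v\in V_K$, - $C_L=\{\mathtt{chr}_L(\mathrm{kp},x)\mid x\in K\}\uplus\{\mathtt{chr}_L(\mathrm{gnd},x)\mid x\in L\setminus K\}$, - $C_R^u=\{\mathtt{chr}_R(\mathrm{gnd},x)\mid x\in R\setminus K\}\uplus\{\mathtt{chr}_R(\mathrm{kp},e)\mid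 e\in E_K\}\uplus\{\mathtt{chr}_R(\mathrm{kp},v')\mid v\in V_K\}$, - $C_R^b=\{\mathrm{var}(v)=\mathrm{var}(v')\wedge\mathrm{dvar}(v')=\mathrm{dvar}(v)-\deg_L(v)+\deg_R(v)\mid v\in V_K\}$. **Graph invariant.** Let $\sigma=\langle\mathbb G;\mathbb B_c\wedge\mathbb B_a;\mathbb V\rangle$, where $\mathbb B_c$ is a conjunction of constraints $X=c$ ($c$ a constant) and $\mathbb B_a$ a conjunction of constraints $X=Y+c_1-c_2$ ($c_1,c_2$ integer constants). Then $\mathcal G(\sigma)$ holds iff there are a finite graph $G$ typed over $TG$ and a conjunction $B$ of constraints $X=c$ with $$\langle\mathbb G;\mathbb B_c\wedge\mathbb B_a\wedge B;\emptyset\rangle\equiv\langle\mathtt{chr}(\mathrm{gnd},G);\top;\emptyset\rangle .$$ An arbitrary state $\sigma$ satisfies $\mathcal G$ as a member of its equivalence class, written $\mathcal G([\sigma])$, iff $\mathcal G(\sigma')$ holds for some $\sigma'\equiv\sigma$ with a store of the above form. **Corollary ($\mathcal G$ Invariant).** For every GTS-CHR program: 1. if $\sigma_0\equiv\sigma_1$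 both have a store of the form $\mathbb B_c\wedge\mathbb B_a$ and $\mathcal G(\sigma_0)$ holds, then $\mathcal G(\sigma_1)$ holds (so $\mathcal G$ does not depend on the representative); 2. if $\sigma_0\rightarrowtail\sigma_1$, both have a store of that form and $\mathcal G(\sigma_0)$ holds, then $\mathcal G(\sigma_1)$ holds; 3. $\mathcal G([\cdot])$ is an invariant on all CHR states: if $\sigma_0\rightarrowtail\sigma_1$ or $\sigma_0\equiv\sigma_1$, and $\mathcal G([\sigma_0])$ holds, then $\mathcal G([\sigma_1])$ holds. -/

import Mathlib

universe u v w

/-! ### Graphs, typed graphs, graph transformation systems -/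

/-- A (finite, directed) graph. -/
structure FinGraph where
  V : Type
  E : Type
  [fintypeV : Fintype V]
  [fintypeE : Fintype E]
  src : E → V
  tgt : E → V

attribute [instance] FinGraph.fintypeV FinGraph.fintypeE

open Classical in
/-- The degree of a node; a loop counts twice. -/
noncomputable def FinGraph.deg (G : FinGraph) (v : G.V) : ℕ :=
  (Finset.univ.filter (fun e => G.src e = v)).card +
    (Finset.univ.filter (fun e => G.tgt e = v)).card

/-- Graph morphisms. -/
structure GraphHom (G H : FinGraph) where
  onV : G.V → H.V
  onE : G.E → H.E
  src_comm : ∀ e, onV (G.src e) = H.src (onE e)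
  tgt_comm : ∀ e, onV (G.tgt e) = H.tgt (onE e)

/-- A graph typed over the type graph `TG`. -/
structure TypedGraph (TG : FinGraph) extends FinGraph where
  type : GraphHom toFinGraph TG

/-- Injective morphisms of typed graphs (inclusions up to renaming of elements). -/
structure TypedEmbedding {TG : FinGraph} (G H : TypedGraph TG)
    extends GraphHom G.toFinGraph H.toFinGraph where
  injV : Function.Injective onV
  injE : Function.Injective onE
  typeV : ∀ v, H.type.onV (onV v) = G.type.onV v
  typeE : ∀ e, H.type.onE (onE e) = G.type.onE e

/-- A graph production rule `L ← K → R`. -/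
structure ProductionRule (TG : FinGraph) where
  L : TypedGraph TG
  K : TypedGraph TG
  R : TypedGraph TG
  l : TypedEmbedding K L
  r : TypedEmbedding K R

/-- A graph transformation system: a type graph and a set of production rules. -/
structure GTS where
  TG : FinGraph
  rules : Set (ProductionRule TG)

/-! ### Built-in constraints and constraint theories -/

/-- The free function symbols (constructors) and the further built-in predicate symbols of a
constraint language, with their arities. Integer numerals, syntactic equality, `⊥` and arithmetic
equations are always present. -/
structure BuiltinSig where
  Fn : Type u
  fnArity : Fn → ℕ
  Pred : Type u
  predArity : Pred → ℕ

/-- First-order terms. -/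
inductive Term (S : BuiltinSig.{u}) (Var : Type v) : Type (max u v)
  | var (x : Var) : Term S Var
  | num (n : ℤ) : Term S Var
  | app (f : S.Fn) (args : Fin (S.fnArity f) → Term S Var) : Term S Var

/-- Arithmetic expressions built with `+` and `-`. -/
inductive ArithExp (Var : Type v) : Type v
  | var (x : Var) : ArithExp Var
  | const (n : ℤ) : ArithExp Var
  | plus (a b : ArithExp Var) : ArithExp Var
  | minus (a b : ArithExp Var) : ArithExp Var

/-- Atomic built-in constraints: `⊥`, syntactic equality `s ≐ t`, arithmetic equality `a = b`, and
the other built-in predicates. Conjunctions of built-in constraints are multisets of atoms; the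
empty conjunction is `⊤`. -/
inductive Builtin (S : BuiltinSig.{u}) (Var : Type v) : Type (max u v)
  | bot : Builtin S Var
  | eq (s t : Term S Var) : Builtin S Var
  | arithEq (a b : ArithExp Var) : Builtin S Var
  | pred (p : S.Pred) (args : Fin (S.predArity p) → Term S Var) : Builtin S Var

section Occurrences

variable {S : BuiltinSig.{u}} {Var : Type v}

/-- Variables occurring in a term. -/
def Term.vars : Term S Var → Set Var
  | .var x => {x}
  | .num _ => ∅
  | .app _ args => ⋃ i, (args i).vars

/-- Simultaneous substitution. -/
def Term.subst (θ : Var → Term S Var) : Term S Var → Term S Var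
  | .var x => θ x
  | .num n => .num n
  | .app f args => .app f (fun i => (args i).subst θ)

/-- Renaming of variables. -/
def Term.rename (ρ : Var → Var) (t : Term S Var) : Term S Var :=
  t.subst (fun x => .var (ρ x))

/-- Constants: numerals and nullary function symbols. -/
def Term.IsConst (t : Term S Var) : Prop :=
  (∃ n : ℤ, t = .num n) ∨ ∃ (f : S.Fn) (args : _), S.fnArity f = 0 ∧ t = .app f args

/-- Variables occurring in an arithmetic expression. -/
def ArithExp.vars : ArithExp Var → Set Var
  | .var x => {x}
  | .const _ => ∅
  | .plus a b => a.vars ∪ b.vars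
  | .minus a b => a.vars ∪ b.vars

/-- Renaming of variables. -/
def ArithExp.rename (ρ : Var → Var) : ArithExp Var → ArithExp Var
  | .var x => .var (ρ x)
  | .const n => .const n
  | .plus a b => .plus (a.rename ρ) (b.rename ρ)
  | .minus a b => .minus (a.rename ρ) (b.rename ρ)

/-- Variables occurring in a built-in constraint. -/
def Builtin.vars : Builtin S Var → Set Var
  | .bot => ∅
  | .eq s t => s.vars ∪ t.vars
  | .arithEq a b => a.vars ∪ b.vars
  | .pred _ args => ⋃ i, (args i).vars

/-- Renaming of variables. -/
def Builtin.rename (ρ : Var → Var) : Builtin S Var → Builtin S Var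
  | .bot => .bot
  | .eq s t => .eq (s.rename ρ) (t.rename ρ)
  | .arithEq a b => .arithEq (a.rename ρ) (b.rename ρ)
  | .pred p args => .pred p (fun i => (args i).rename ρ)

end Occurrences

/-- An interpretation of the constraint language. -/
structure Interp (S : BuiltinSig.{u}) where
  Carrier : Type w
  num : ℤ → Carrier
  fn : ∀ f : S.Fn, (Fin (S.fnArity f) → Carrier) → Carrier
  pred : ∀ p : S.Pred, (Fin (S.predArity p) → Carrier) → Prop

section Semantics

variable {S : BuiltinSig.{u}} {Var : Type v}

/-- Value of a term under a valuation. -/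
def Term.eval (I : Interp.{u, w} S) (α : Var → I.Carrier) : Term S Var → I.Carrier
  | .var x => α x
  | .num n => I.num n
  | .app f args => I.fn f (fun i => (args i).eval I α)

/-- `a.Evaluates I α n`: under `α` all variables of `a` denote integers and `a` has value `n`. -/
def ArithExp.Evaluates (I : Interp.{u, w} S) (α : Var → I.Carrier) : ArithExp Var → ℤ → Prop
  | .var x, n => α x = I.num n
  | .const k, n => n = k
  | .plus a b, n => ∃ i j, a.Evaluates I α i ∧ b.Evaluates I α j ∧ n = i + j
  | .minus a b, n => ∃ i j, a.Evaluates I α i ∧ b.Evaluates I α j ∧ n = i - j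

/-- Truth of an atomic built-in constraint under a valuation. -/
def Builtin.Holds (I : Interp.{u, w} S) (α : Var → I.Carrier) : Builtin S Var → Prop
  | .bot => False
  | .eq s t => s.eval I α = t.eval I α
  | .arithEq a b => ∃ n, a.Evaluates I α n ∧ b.Evaluates I α n
  | .pred p args => I.pred p (fun i => (args i).eval I α)

end Semantics

/-- A (complete) constraint theory, given as the theory of a structure `CT.toInterp` whose
syntactic equality satisfies Clark's equality theory (constructors and numerals are injective, have
pairwise disjoint ranges, and the occurs check holds) and whose numerals are the integers with
`+` and `-`. All other predicates are arbitrary. -/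
structure ConstraintTheory (S : BuiltinSig.{u}) extends Interp.{u, w} S where
  num_inj : Function.Injective num
  fn_inj : ∀ f, Function.Injective (fn f)
  fn_ne_fn : ∀ f g, f ≠ g → ∀ a b, fn f a ≠ fn g b
  fn_ne_num : ∀ f a n, fn f a ≠ num n
  occurs_check : ∀ (t : Term S ℕ) (x : ℕ) (α : ℕ → Carrier),
    x ∈ t.vars → t ≠ .var x → α x ≠ t.eval toInterp α

/-! ### CHR states, state equivalence, rules and transitions -/

/-- The user-defined constraint symbols with their arities. -/
structure UserSig where
  Sym : Type
  arity : Sym → ℕ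

/-- A user-defined constraint `c(t₁, …, tₙ)`. -/
structure UserConstraint (S : BuiltinSig.{u}) (U : UserSig) (Var : Type v) where
  sym : U.Sym
  args : Fin (U.arity sym) → Term S Var

/-- A conjunction of built-in constraints. -/
abbrev Store (S : BuiltinSig.{u}) (Var : Type v) := Multiset (Builtin S Var)

/-- A multiset of user-defined constraints. -/
abbrev Goal (S : BuiltinSig.{u}) (U : UserSig) (Var : Type v) := Multiset (UserConstraint S U Var)

/-- A CHR state: goal, built-in store, and set of global variables. -/
structure CHRState (S : BuiltinSig.{u}) (U : UserSig) (Var : Type v) where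
  goal : Goal S U Var
  store : Store S Var
  globals : Finset Var

/-- A CHR rule `kept \ removed ⇔ guard | bodyU, bodyB`. -/
structure CHRRule (S : BuiltinSig.{u}) (U : UserSig) (Var : Type v) where
  kept : Goal S U Var
  removed : Goal S U Var
  guard : Store S Var
  bodyU : Goal S U Var
  bodyB : Store S Var

section CHR

variable {S : BuiltinSig.{u}} {U : UserSig} {Var : Type v}

/-- Variables occurring in a user-defined constraint. -/
def UserConstraint.vars (c : UserConstraint S U Var) : Set Var := ⋃ i, (c.args i).vars

/-- Simultaneous substitution. -/
def UserConstraint.subst (θ : Var → Term S Var) (c : UserConstraint S U Var) :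
    UserConstraint S U Var :=
  ⟨c.sym, fun i => (c.args i).subst θ⟩

/-- Variables occurring in a goal. -/
def goalVars (G : Goal S U Var) : Set Var := {x | ∃ c ∈ G, x ∈ c.vars}

/-- Variables occurring in a built-in store. -/
def storeVars (B : Store S Var) : Set Var := {x | ∃ b ∈ B, x ∈ b.vars}

open Classical in
/-- The goal `G[x/t]`. -/
noncomputable def goalSubst (G : Goal S U Var) (x : Var) (t : Term S Var) : Goal S U Var :=
  G.map (UserConstraint.subst (Function.update Term.var x t))

/-- Renaming of variables in a goal. -/
def goalRename (ρ : Var → Var) (G : Goal S U Var) : Goal S U Var :=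
  G.map (UserConstraint.subst (fun x => .var (ρ x)))

/-- Renaming of variables in a built-in store. -/
def storeRename (ρ : Var → Var) (B : Store S Var) : Store S Var := B.map (Builtin.rename ρ)

/-- Truth of a conjunction of built-in constraints. -/
def StoreHolds (I : Interp.{u, w} S) (α : Var → I.Carrier) (B : Store S Var) : Prop :=
  ∀ b ∈ B, b.Holds I α

/-- The strictly local variables of the store `B` in the state `⟨G; B; V⟩`. -/
def strictlyLocal (G : Goal S U Var) (B : Store S Var) (V : Finset Var) : Set Var :=
  {x | x ∈ storeVars B ∧ x ∉ V ∧ x ∉ goalVars G}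

/-- The formula `∃ s̄. B` under the valuation `α`, for a set `s` of variables. -/
def ExistsHolds (I : Interp.{u, w} S) (α : Var → I.Carrier) (s : Set Var) (B : Store S Var) :
    Prop :=
  ∃ β : Var → I.Carrier, (∀ x, x ∉ s → β x = α x) ∧ StoreHolds I β B

open Classical in
/-- The four conditions that generate state equivalence. -/
inductive EquivGenerator (CT : ConstraintTheory.{u, w} S) :
    CHRState S U Var → CHRState S U Var → Prop
  /-- Substitution. -/
  | substitution (G : Goal S U Var) (B : Store S Var) (V : Finset Var) (x : Var)
      (t : Term S Var) :
      EquivGenerator CT ⟨G, {Builtin.eq (.var x) t} + B, V⟩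
        ⟨goalSubst G x t, {Builtin.eq (.var x) t} + B, V⟩
  /-- Transformation of the constraint store. -/
  | transformation (G : Goal S U Var) (B₁ B₂ : Store S Var) (V : Finset Var)
      (h : ∀ α : Var → CT.Carrier,
        ExistsHolds CT.toInterp α (strictlyLocal G B₁ V) B₁ ↔
          ExistsHolds CT.toInterp α (strictlyLocal G B₂ V) B₂) :
      EquivGenerator CT ⟨G, B₁, V⟩ ⟨G, B₂, V⟩
  /-- Omission of non-occurring global variables. -/
  | omission (G : Goal S U Var) (B : Store S Var) (V : Finset Var) (x : Var)
      (hG : x ∉ goalVars G) (hB : x ∉ storeVars B) :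
      EquivGenerator CT ⟨G, B, insert x V⟩ ⟨G, B, V⟩
  /-- Equivalence of failed states. -/
  | failed (G₁ G₂ : Goal S U Var) (V : Finset Var) :
      EquivGenerator CT ⟨G₁, {Builtin.bot}, V⟩ ⟨G₂, {Builtin.bot}, V⟩

/-- State equivalence: the smallest equivalence relation satisfying the four conditions. -/
def StateEquiv (CT : ConstraintTheory.{u, w} S) : CHRState S U Var → CHRState S U Var → Prop :=
  Relation.EqvGen (EquivGenerator CT)

/-- Variables occurring in the head of a rule. -/
def CHRRule.headVars (r : CHRRule S U Var) : Set Var := goalVars r.kept ∪ goalVars r.removed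

/-- Variables occurring in a rule. -/
def CHRRule.vars (r : CHRRule S U Var) : Set Var :=
  r.headVars ∪ storeVars r.guard ∪ goalVars r.bodyU ∪ storeVars r.bodyB

/-- The copy of a rule under a renaming of its variables. -/
def CHRRule.rename (ρ : Var → Var) (r : CHRRule S U Var) : CHRRule S U Var :=
  ⟨goalRename ρ r.kept, goalRename ρ r.removed, storeRename ρ r.guard, goalRename ρ r.bodyU,
    storeRename ρ r.bodyB⟩

/-- The transition relation of the program `P`, on equivalence classes of states. A rule is applied
through a copy with fresh variables: no variable of the copy is global, and those that do not occur
in its head do not occur anywhere else in the state. The head variables of the copy may occur in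
the rest `⟨G; B⟩` of the representative, since this is how they are matched with the state. -/
def Transition (CT : ConstraintTheory.{u, w} S) (P : Set (CHRRule S U Var))
    (σ τ : CHRState S U Var) : Prop :=
  ∃ r ∈ P, ∃ ρ : Var → Var, Set.InjOn ρ r.vars ∧
    ∃ (c : CHRRule S U Var) (G : Goal S U Var) (B : Store S Var) (V : Finset Var),
      c = r.rename ρ ∧
      (∀ x ∈ c.vars, x ∉ V) ∧
      (∀ x ∈ c.vars, x ∉ c.headVars → x ∉ goalVars G ∧ x ∉ storeVars B) ∧
      StateEquiv CT σ ⟨c.kept + c.removed + G, c.guard + B, V⟩ ∧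
      StateEquiv CT τ ⟨c.kept + c.bodyU + G, c.guard + c.bodyB + B, V⟩

/-- `Inv` is an invariant of the program `P`: it is preserved by transitions and by state
equivalence. -/
def IsProgramInvariant (CT : ConstraintTheory.{u, w} S) (P : Set (CHRRule S U Var))
    (Inv : CHRState S U Var → Prop) : Prop :=
  ∀ σ₀ σ₁, (Transition CT P σ₀ σ₁ ∨ StateEquiv CT σ₀ σ₁) → Inv σ₀ → Inv σ₁

end CHR

/-! ### Encoding of graphs and production rules -/

/-- The constraint symbols for graphs typed over `TG`: `v/2` for nodes, `e/3` for edges. -/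
abbrev graphSig (TG : FinGraph) : UserSig where
  Sym := TG.V ⊕ TG.E
  arity := Sum.elim (fun _ => 2) (fun _ => 3)

/-- The mappings `var` and `dvar` from a set of graph elements to variables: both are injective,
and no variable is used by both. -/
structure Naming (X : Type) (Var : Type v) where
  var : X → Var
  dvar : X → Var
  var_inj : Function.Injective var
  dvar_inj : Function.Injective dvar
  var_ne_dvar : ∀ x y, var x ≠ dvar y

section Encoding

variable {S : BuiltinSig.{u}} {Var : Type v} {TG : FinGraph}

/-- The node constraint `t(x, d)`. -/
def nodeConstraint (t : TG.V) (x : Var) (d : Term S Var) : UserConstraint S (graphSig TG) Var :=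
  ⟨Sum.inl t, ![.var x, d]⟩

/-- The edge constraint `t(x, y, z)`. -/
def edgeConstraint (t : TG.E) (x y z : Var) : UserConstraint S (graphSig TG) Var :=
  ⟨Sum.inr t, ![.var x, .var y, .var z]⟩

/-- The encoding `chr(gnd, G)` of a host graph. -/
noncomputable def chrGnd (G : TypedGraph TG) (ν : Naming (G.V ⊕ G.E) Var) :
    Goal S (graphSig TG) Var :=
  Finset.univ.val.map (fun v : G.V =>
      nodeConstraint (G.type.onV v) (ν.var (.inl v)) (.num (G.deg v))) +
    Finset.univ.val.map (fun e : G.E =>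
      edgeConstraint (G.type.onE e) (ν.var (.inr e)) (ν.var (.inl (G.src e)))
        (ν.var (.inl (G.tgt e))))

/-- The graph elements named by the encoding of a production rule: the elements of `L`, the
elements of `R` outside `K`, and a copy `v'` of each node `v` of `K`. (The elements of `K` are
identified with their images in `L`.) -/
inductive RuleItem (p : ProductionRule TG) : Type
  | leftV (v : p.L.V) : RuleItem p
  | leftE (e : p.L.E) : RuleItem p
  | newV (v : {v : p.R.V // v ∉ Set.range p.r.onV}) : RuleItem p
  | newE (e : {e : p.R.E // e ∉ Set.range p.r.onE}) : RuleItem p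
  | copyV (v : p.K.V) : RuleItem p

open Classical in
/-- The name of a node of `R`. -/
noncomputable def ProductionRule.rightV (p : ProductionRule TG) (v : p.R.V) : RuleItem p :=
  if h : v ∈ Set.range p.r.onV then .leftV (p.l.onV h.choose) else .newV ⟨v, h⟩

open Classical in
/-- The name of an edge of `R`. -/
noncomputable def ProductionRule.rightE (p : ProductionRule TG) (e : p.R.E) : RuleItem p :=
  if h : e ∈ Set.range p.r.onE then .leftE (p.l.onE h.choose) else .newE ⟨e, h⟩

/-- The constraint of a node of `L` with its degree variable. -/
def ProductionRule.leftNodeKp (p : ProductionRule TG) (ν : Naming (RuleItem p) Var) (v : p.L.V) :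
    UserConstraint S (graphSig TG) Var :=
  nodeConstraint (p.L.type.onV v) (ν.var (.leftV v)) (.var (ν.dvar (.leftV v)))

/-- The constraint of a node of `L` with its degree in `L`. -/
noncomputable def ProductionRule.leftNodeGnd (p : ProductionRule TG)
    (ν : Naming (RuleItem p) Var) (v : p.L.V) : UserConstraint S (graphSig TG) Var :=
  nodeConstraint (p.L.type.onV v) (ν.var (.leftV v)) (.num (p.L.deg v))

/-- The constraint of an edge of `L`. -/
def ProductionRule.leftEdge (p : ProductionRule TG) (ν : Naming (RuleItem p) Var) (e : p.L.E) :
    UserConstraint S (graphSig TG) Var :=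
  edgeConstraint (p.L.type.onE e) (ν.var (.leftE e)) (ν.var (.leftV (p.L.src e)))
    (ν.var (.leftV (p.L.tgt e)))

/-- The constraint of a node of `R` with its degree in `R`. -/
noncomputable def ProductionRule.rightNodeGnd (p : ProductionRule TG)
    (ν : Naming (RuleItem p) Var) (v : p.R.V) : UserConstraint S (graphSig TG) Var :=
  nodeConstraint (p.R.type.onV v) (ν.var (p.rightV v)) (.num (p.R.deg v))

/-- The constraint of an edge of `R`. -/
noncomputable def ProductionRule.rightEdge (p : ProductionRule TG)
    (ν : Naming (RuleItem p) Var) (e : p.R.E) : UserConstraint S (graphSig TG) Var :=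
  edgeConstraint (p.R.type.onE e) (ν.var (p.rightE e)) (ν.var (p.rightV (p.R.src e)))
    (ν.var (p.rightV (p.R.tgt e)))

/-- The constraint of the copy `v'` of a node `v` of `K`, with its degree variable. -/
def ProductionRule.copyNodeKp (p : ProductionRule TG) (ν : Naming (RuleItem p) Var) (v : p.K.V) :
    UserConstraint S (graphSig TG) Var :=
  nodeConstraint (p.R.type.onV (p.r.onV v)) (ν.var (.copyV v)) (.var (ν.dvar (.copyV v)))

open Classical in
/-- The simplification rule `C_L ⇔ C_R^u, C_R^b` that encodes a production rule. -/
noncomputable def ProductionRule.encode (p : ProductionRule TG) (ν : Naming (RuleItem p) Var) :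
    CHRRule S (graphSig TG) Var where
  kept := 0
  removed :=
    Finset.univ.val.map (fun v : p.K.V => p.leftNodeKp ν (p.l.onV v)) +
    Finset.univ.val.map (fun e : p.K.E => p.leftEdge ν (p.l.onE e)) +
    (Finset.univ.filter (· ∉ Set.range p.l.onV)).val.map (p.leftNodeGnd ν) +
    (Finset.univ.filter (· ∉ Set.range p.l.onE)).val.map (p.leftEdge ν)
  guard := 0
  bodyU :=
    (Finset.univ.filter (· ∉ Set.range p.r.onV)).val.map (p.rightNodeGnd ν) +
    (Finset.univ.filter (· ∉ Set.range p.r.onE)).val.map (p.rightEdge ν) +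
    Finset.univ.val.map (fun e : p.K.E => p.rightEdge ν (p.r.onE e)) +
    Finset.univ.val.map (p.copyNodeKp ν)
  bodyB :=
    Finset.univ.val.map (fun v : p.K.V =>
      Builtin.eq (.var (ν.var (.leftV (p.l.onV v)))) (.var (ν.var (.copyV v)))) +
    Finset.univ.val.map (fun v : p.K.V =>
      Builtin.arithEq (.var (ν.dvar (.copyV v)))
        (.plus
          (.minus (.var (ν.dvar (.leftV (p.l.onV v)))) (.const (p.L.deg (p.l.onV v))))
          (.const (p.R.deg (p.r.onV v)))))

/-- The GTS-CHR program of a graph transformation system, for a choice of the variable names. -/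
def GTS.program (T : GTS) (ν : ∀ p : ProductionRule T.TG, Naming (RuleItem p) Var) :
    Set (CHRRule S (graphSig T.TG) Var) :=
  {r | ∃ p ∈ T.rules, r = p.encode (ν p)}

/-! ### The graph invariant -/

/-- Constraints of the form `X = c` for a constant `c`. -/
def IsConstEq (b : Builtin S Var) : Prop :=
  ∃ (x : Var) (c : Term S Var), c.IsConst ∧ b = .eq (.var x) c

/-- Constraints of the form `X = Y + c₁ - c₂` for constants `c₁, c₂`. -/
def IsOffsetEq (b : Builtin S Var) : Prop :=
  ∃ (x y : Var) (c₁ c₂ : ℤ),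
    b = .arithEq (.var x) (.minus (.plus (.var y) (.const c₁)) (.const c₂))

/-- The built-in store is of the form `B_c ∧ B_a`. -/
def HasDegreeStore {U : UserSig} (σ : CHRState S U Var) : Prop :=
  ∀ b ∈ σ.store, IsConstEq b ∨ IsOffsetEq b

/-- The graph invariant for a state whose store is of the form `B_c ∧ B_a`: for some graph `G` and
some conjunction `B` of constraints `X = c`, the state `⟨G; B_c ∧ B_a ∧ B; ∅⟩` is equivalent to
`⟨chr(gnd, G); ⊤; ∅⟩`. -/
def GraphInvariantAt (CT : ConstraintTheory.{u, w} S) (σ : CHRState S (graphSig TG) Var) : Prop :=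
  HasDegreeStore σ ∧
    ∃ (G : TypedGraph TG) (ν : Naming (G.V ⊕ G.E) Var) (B : Store S Var),
      (∀ b ∈ B, IsConstEq b) ∧
      StateEquiv CT ⟨σ.goal, σ.store + B, ∅⟩ ⟨chrGnd G ν, 0, ∅⟩

/-- The graph invariant on all states, a state being identified with its equivalence class: it
holds for the representatives of the class with a store of the form `B_c ∧ B_a`. -/
def GraphInvariant (CT : ConstraintTheory.{u, w} S) (σ : CHRState S (graphSig TG) Var) : Prop :=
  ∃ σ' : CHRState S (graphSig TG) Var, StateEquiv CT σ σ' ∧ GraphInvariantAt CT σ'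

end Encoding

/-! ### Dependence on variables, renaming, and finiteness of variable sets. -/

section Occurrences

variable {S : BuiltinSig.{u}} {U : UserSig} {Var : Type v}

/-! State equivalence is syntactic and hard to analyse along chains of generators, so it is replaced
by a semantic relation. Index the goal of a state by a finite type; `Sem` relates values of the
globals to the tuples of ground constraints that the goal can take under solutions of the store.
Each generator preserves this relation up to re-indexing, failed states aside (`StateEquiv.semEq`).
Conversely, since fresh variables are available, equal relations give equivalent states
(`StateEquiv.of_sem`).

The graph invariant then has a semantic form, `EncodesGraph`: the goal can be indexed by the
elements of a graph `G` so that all encodings of `G`, with arbitrary identifiers and the true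
degrees, are attained, and every attained tuple with the true degrees is such an encoding. It does
not mention the shape of the store and passes along equivalence. For stores of the form `B_c ∧ B_a`
it coincides with the invariant (`GraphInvariantAt.encodesGraph`, `EncodesGraph.graphInvariantAt`).
The point is that added equations `X = c` determine only variables linked to constants by offset
equations, and never an identifier, because identifiers take every value.

For a transition, `sem_step` describes the new values through the old ones, and `Encodes.step` is
the underlying graph rewriting. A deleted node is matched with its degree in `L`, which must be its
degree in the host graph; hence no context edge is attached to it, and `R` can be glued to the
context. The arithmetic constraint updates the degrees of preserved nodes correctly.

The statement about all states also needs an admissible store after the step, although the body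
contains equations between variables. `exists_degreeStore_step` removes these by reusing the old
identifier terms of preserved elements. -/

theorem Term.eval_congr (I : Interp.{u, w} S) {α β : Var → I.Carrier} (t : Term S Var)
    (h : ∀ x ∈ t.vars, α x = β x) : t.eval I α = t.eval I β := by
  induction t with
  | var x => exact h x rfl
  | num n => rfl
  | app f args ih =>
    simp only [Term.eval]
    congr 1
    funext i
    exact ih i fun x hx => h x (Set.mem_iUnion.2 ⟨i, hx⟩)

theorem Term.eval_subst (I : Interp.{u, w} S) (α : Var → I.Carrier) (θ : Var → Term S Var)
    (t : Term S Var) : (t.subst θ).eval I α = t.eval I (fun x => (θ x).eval I α) := by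
  induction t with
  | var x => rfl
  | num n => rfl
  | app f args ih => simp only [Term.subst, Term.eval, ih]

theorem Term.eval_rename (I : Interp.{u, w} S) (α : Var → I.Carrier) (ρ : Var → Var)
    (t : Term S Var) : (t.rename ρ).eval I α = t.eval I (α ∘ ρ) :=
  t.eval_subst I α _

theorem Term.vars_rename (ρ : Var → Var) (t : Term S Var) : (t.rename ρ).vars = ρ '' t.vars := by
  unfold Term.rename
  induction t with
  | var x => simp [Term.subst, Term.vars]
  | num n => simp [Term.subst, Term.vars]
  | app f args ih => simp only [Term.subst, Term.vars, ih, Set.image_iUnion]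

theorem Term.subst_eq_self {θ : Var → Term S Var} (t : Term S Var)
    (h : ∀ x ∈ t.vars, θ x = .var x) : t.subst θ = t := by
  induction t with
  | var x => exact h x rfl
  | num n => rfl
  | app f args ih =>
    simp only [Term.subst]
    congr 1
    funext i
    exact ih i fun x hx => h x (Set.mem_iUnion.2 ⟨i, hx⟩)

theorem Term.vars_finite (t : Term S Var) : t.vars.Finite := by
  induction t with
  | var x => exact Set.finite_singleton x
  | num n => exact Set.finite_empty
  | app f args ih => exact Set.finite_iUnion ih

theorem ArithExp.evaluates_congr (I : Interp.{u, w} S) {α β : Var → I.Carrier} (a : ArithExp Var)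
    (h : ∀ x ∈ a.vars, α x = β x) (n : ℤ) : a.Evaluates I α n ↔ a.Evaluates I β n := by
  induction a generalizing n with
  | var x => simp only [ArithExp.Evaluates, h x rfl]
  | const k => rfl
  | plus a b iha ihb | minus a b iha ihb =>
    simp only [ArithExp.Evaluates, iha fun x hx => h x (.inl hx), ihb fun x hx => h x (.inr hx)]

theorem ArithExp.evaluates_rename (I : Interp.{u, w} S) (α : Var → I.Carrier) (ρ : Var → Var)
    (a : ArithExp Var) (n : ℤ) : (a.rename ρ).Evaluates I α n ↔ a.Evaluates I (α ∘ ρ) n := by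
  induction a generalizing n with
  | var x => rfl
  | const k => rfl
  | plus a b iha ihb | minus a b iha ihb => simp only [ArithExp.rename, ArithExp.Evaluates, iha, ihb]

theorem ArithExp.vars_rename (ρ : Var → Var) (a : ArithExp Var) :
    (a.rename ρ).vars = ρ '' a.vars := by
  induction a with
  | var x => simp [ArithExp.rename, ArithExp.vars]
  | const k => simp [ArithExp.rename, ArithExp.vars]
  | plus a b iha ihb | minus a b iha ihb =>
    simp only [ArithExp.rename, ArithExp.vars, iha, ihb, Set.image_union]

theorem ArithExp.vars_finite (a : ArithExp Var) : a.vars.Finite := by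
  induction a with
  | var x => exact Set.finite_singleton x
  | const k => exact Set.finite_empty
  | plus a b iha ihb | minus a b iha ihb => exact iha.union ihb

theorem Builtin.holds_congr (I : Interp.{u, w} S) {α β : Var → I.Carrier} (b : Builtin S Var)
    (h : ∀ x ∈ b.vars, α x = β x) : b.Holds I α ↔ b.Holds I β := by
  cases b with
  | bot => rfl
  | eq s t =>
    simp only [Builtin.Holds, s.eval_congr I fun x hx => h x (.inl hx),
      t.eval_congr I fun x hx => h x (.inr hx)]
  | arithEq s t =>
    simp only [Builtin.Holds, s.evaluates_congr I fun x hx => h x (.inl hx),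
      t.evaluates_congr I fun x hx => h x (.inr hx)]
  | pred p args =>
    simp only [Builtin.Holds,
      fun i => (args i).eval_congr I fun x hx => h x (Set.mem_iUnion.2 ⟨i, hx⟩)]

theorem Builtin.holds_rename (I : Interp.{u, w} S) (α : Var → I.Carrier) (ρ : Var → Var)
    (b : Builtin S Var) : (b.rename ρ).Holds I α ↔ b.Holds I (α ∘ ρ) := by
  cases b <;>
    simp only [Builtin.rename, Builtin.Holds, Term.eval_rename, ArithExp.evaluates_rename]

theorem Builtin.vars_rename (ρ : Var → Var) (b : Builtin S Var) :
    (b.rename ρ).vars = ρ '' b.vars := by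
  cases b <;> simp only [Builtin.rename, Builtin.vars, Term.vars_rename, ArithExp.vars_rename,
    Set.image_union, Set.image_iUnion, Set.image_empty]

theorem Builtin.vars_finite (b : Builtin S Var) : b.vars.Finite := by
  cases b with
  | bot => exact Set.finite_empty
  | eq s t => exact s.vars_finite.union t.vars_finite
  | arithEq s t => exact s.vars_finite.union t.vars_finite
  | pred p args => exact Set.finite_iUnion fun i => (args i).vars_finite

theorem storeHolds_congr (I : Interp.{u, w} S) {α β : Var → I.Carrier} (B : Store S Var)
    (h : ∀ x ∈ storeVars B, α x = β x) : StoreHolds I α B ↔ StoreHolds I β B :=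
  forall₂_congr fun b hb => b.holds_congr I fun x hx => h x ⟨b, hb, hx⟩

theorem storeHolds_rename (I : Interp.{u, w} S) (α : Var → I.Carrier) (ρ : Var → Var)
    (B : Store S Var) : StoreHolds I α (storeRename ρ B) ↔ StoreHolds I (α ∘ ρ) B := by
  simp [StoreHolds, storeRename, Builtin.holds_rename]

@[simp] theorem storeHolds_add (I : Interp.{u, w} S) (α : Var → I.Carrier) (A B : Store S Var) :
    StoreHolds I α (A + B) ↔ StoreHolds I α A ∧ StoreHolds I α B := by
  simp [StoreHolds, or_imp, forall_and]

@[simp] theorem storeHolds_zero (I : Interp.{u, w} S) (α : Var → I.Carrier) :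
    StoreHolds I α 0 := by
  simp [StoreHolds]

theorem storeVars_rename (ρ : Var → Var) (B : Store S Var) :
    storeVars (storeRename ρ B) = ρ '' storeVars B := by
  ext x
  simp only [storeVars, storeRename, Multiset.mem_map, Set.mem_ofPred_eq, Set.mem_image]
  constructor
  · rintro ⟨_, ⟨b, hb, rfl⟩, hx⟩
    rw [Builtin.vars_rename] at hx
    obtain ⟨y, hy, rfl⟩ := hx
    exact ⟨y, ⟨b, hb, hy⟩, rfl⟩
  · rintro ⟨y, ⟨b, hb, hy⟩, rfl⟩
    exact ⟨_, ⟨b, hb, rfl⟩, by rw [Builtin.vars_rename]; exact ⟨y, hy, rfl⟩⟩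

theorem storeVars_finite (B : Store S Var) : (storeVars B).Finite := by
  have : storeVars B = ⋃ b ∈ {b | b ∈ B}, b.vars := by ext; simp [storeVars]
  rw [this]
  exact (Multiset.finite_toSet B).biUnion fun b _ => b.vars_finite

theorem UserConstraint.vars_finite (c : UserConstraint S U Var) : c.vars.Finite :=
  Set.finite_iUnion fun i => (c.args i).vars_finite

theorem UserConstraint.vars_rename (ρ : Var → Var) (c : UserConstraint S U Var) :
    (c.subst fun x => .var (ρ x)).vars = ρ '' c.vars := by
  simp only [UserConstraint.vars, UserConstraint.subst, Set.image_iUnion]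
  exact Set.iUnion_congr fun i => Term.vars_rename ρ _

theorem goalVars_finite (G : Goal S U Var) : (goalVars G).Finite := by
  have : goalVars G = ⋃ c ∈ {c | c ∈ G}, c.vars := by ext; simp [goalVars]
  rw [this]
  exact (Multiset.finite_toSet G).biUnion fun b _ => b.vars_finite

theorem goalVars_rename (ρ : Var → Var) (G : Goal S U Var) :
    goalVars (goalRename ρ G) = ρ '' goalVars G := by
  ext x
  simp only [goalVars, goalRename, Multiset.mem_map, Set.mem_ofPred_eq, Set.mem_image]
  constructor
  · rintro ⟨_, ⟨b, hb, rfl⟩, hx⟩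
    rw [UserConstraint.vars_rename] at hx
    obtain ⟨y, hy, rfl⟩ := hx
    exact ⟨y, ⟨b, hb, hy⟩, rfl⟩
  · rintro ⟨y, ⟨b, hb, hy⟩, rfl⟩
    exact ⟨_, ⟨b, hb, rfl⟩, by rw [UserConstraint.vars_rename]; exact ⟨y, hy, rfl⟩⟩

theorem CHRRule.headVars_rename (ρ : Var → Var) (r : CHRRule S U Var) :
    (r.rename ρ).headVars = ρ '' r.headVars := by
  simp only [CHRRule.headVars, CHRRule.rename, goalVars_rename, Set.image_union]

theorem CHRRule.vars_rename (ρ : Var → Var) (r : CHRRule S U Var) :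
    (r.rename ρ).vars = ρ '' r.vars := by
  simp only [CHRRule.vars, CHRRule.headVars_rename]
  simp only [CHRRule.rename, goalVars_rename, storeVars_rename, Set.image_union]

end Occurrences

/-! ### Finite multisets as indexed families. -/

section Presentation

/-- Two families with the same multiset of values differ by a bijection of the index types. -/
theorem exists_equiv_of_map_univ_eq {ι κ X : Type*} [Fintype ι] [Fintype κ] {g : ι → X} {h : κ → X}
    (e : Finset.univ.val.map g = Finset.univ.val.map h) : ∃ φ : ι ≃ κ, ∀ i, h (φ i) = g i := by
  classical
  -- Both fibres over `x` have the multiplicity of `x` as cardinality; bijections of the fibres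
  -- assemble to one of the index types.
  have key : ∀ x, Nonempty ({i // g i = x} ≃ {k // h k = x}) := fun x => by
    have h1 := congrArg (Multiset.count x) e
    rw [Multiset.count_map, Multiset.count_map] at h1
    refine ⟨Fintype.equivOfCardEq ?_⟩
    rw [Fintype.card_subtype, Fintype.card_subtype]
    simpa [Finset.card, eq_comm] using h1
  let f := fun x => (key x).some
  refine ⟨(Equiv.sigmaFiberEquiv g).symm.trans
    ((Equiv.sigmaCongrRight fun x => (f x)).trans (Equiv.sigmaFiberEquiv h)), fun i => ?_⟩
  exact ((f (g i)) ⟨i, rfl⟩).2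

theorem exists_family {X : Type*} (G : Multiset X) :
    ∃ (n : ℕ) (g : Fin n → X), Finset.univ.val.map g = G := by
  induction G using Quotient.inductionOn with
  | h l => exact ⟨l.length, l.get, by simp [Fin.univ_val_map]⟩

theorem map_univ_sumElim {ι κ X : Type*} [Fintype ι] [Fintype κ] (g : ι → X) (h : κ → X) :
    Finset.univ.val.map (Sum.elim g h) = Finset.univ.val.map g + Finset.univ.val.map h := by
  rw [← Finset.univ_disjSum_univ, Finset.val_disjSum, Multiset.disjSum]
  simp [Multiset.map_map, Function.comp_def]

theorem map_univ_comp_equiv {ι κ X : Type*} [Fintype ι] [Fintype κ] (φ : ι ≃ κ) (h : κ → X) :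
    Finset.univ.val.map (fun i => h (φ i)) = Finset.univ.val.map h := by
  rw [← Multiset.map_univ_val_equiv φ, Multiset.map_map]
  rfl

end Presentation

/-! ### Semantic equivalence of states and soundness of state equivalence. -/

section Semantics

variable {S : BuiltinSig.{u}} {U : UserSig} {Var : Type v}

/-- The value of a user-defined constraint under a valuation. -/
def UserConstraint.ground (I : Interp.{u, w} S) (α : Var → I.Carrier)
    (c : UserConstraint S U Var) : U.Sym × List I.Carrier :=
  (c.sym, List.ofFn fun i => (c.args i).eval I α)

theorem UserConstraint.ground_congr (I : Interp.{u, w} S) {α β : Var → I.Carrier}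
    (c : UserConstraint S U Var) (h : ∀ x ∈ c.vars, α x = β x) : c.ground I α = c.ground I β := by
  simp only [UserConstraint.ground]
  congr 2
  funext i
  exact (c.args i).eval_congr I fun x hx => h x (Set.mem_iUnion.2 ⟨i, hx⟩)

theorem UserConstraint.ground_subst (I : Interp.{u, w} S) (α : Var → I.Carrier)
    (θ : Var → Term S Var) (c : UserConstraint S U Var) :
    (c.subst θ).ground I α = c.ground I fun x => (θ x).eval I α := by
  simp only [UserConstraint.ground, UserConstraint.subst, Term.eval_subst]

theorem UserConstraint.ground_rename (I : Interp.{u, w} S) (α : Var → I.Carrier)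
    (ρ : Var → Var) (c : UserConstraint S U Var) :
    (c.subst fun x => .var (ρ x)).ground I α = c.ground I (α ∘ ρ) :=
  c.ground_subst I α _

theorem mem_goalVars {ι : Type*} [Fintype ι] {g : ι → UserConstraint S U Var} {x : Var} :
    x ∈ goalVars (Finset.univ.val.map g) ↔ ∃ i, x ∈ (g i).vars := by
  simp [goalVars]

theorem ground_congr_of_goalVars (I : Interp.{u, w} S) {ι : Type*} [Fintype ι]
    {g : ι → UserConstraint S U Var} {G : Goal S U Var} (hg : Finset.univ.val.map g = G)
    {α β : Var → I.Carrier} (h : ∀ x ∈ goalVars G, α x = β x) (i : ι) :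
    (g i).ground I α = (g i).ground I β :=
  (g i).ground_congr I fun x hx => h x (by rw [← hg]; exact mem_goalVars.2 ⟨i, hx⟩)

/-- The state with goal `g`, store `B` and globals `V` can take the values `M` on its goal while
its globals have the values given by `γ`. -/
def Sem (I : Interp.{u, w} S) {ι : Type*} (g : ι → UserConstraint S U Var) (B : Store S Var)
    (V : Finset Var) (γ : Var → I.Carrier) (M : ι → U.Sym × List I.Carrier) : Prop :=
  ∃ α : Var → I.Carrier, (∀ x ∈ V, α x = γ x) ∧ StoreHolds I α B ∧ ∀ i, (g i).ground I α = M i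

theorem sem_comp_equiv {I : Interp.{u, w} S} {ι κ : Type*} (φ : ι ≃ κ)
    {g : κ → UserConstraint S U Var} {B : Store S Var} {V : Finset Var} {γ : Var → I.Carrier}
    {M : ι → U.Sym × List I.Carrier} :
    Sem I (fun i => g (φ i)) B V γ M ↔ Sem I g B V γ fun k => M (φ.symm k) := by
  refine exists_congr fun α => and_congr_right fun _ => and_congr_right fun _ => ?_
  exact ⟨fun h k => by simpa using h (φ.symm k), fun h i => by simpa using h (φ i)⟩

/-- Semantic equivalence of states: both are unsatisfiable, or for a suitable matching of the goals
they can take the same values. -/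
def SemEq (I : Interp.{u, w} S) (σ τ : CHRState S U Var) : Prop :=
  ((∀ α, ¬ StoreHolds I α σ.store) ∧ ∀ α, ¬ StoreHolds I α τ.store) ∨
    ∃ (n : ℕ) (g h : Fin n → UserConstraint S U Var),
      Finset.univ.val.map g = σ.goal ∧ Finset.univ.val.map h = τ.goal ∧
      ∀ γ M, Sem I g σ.store σ.globals γ M ↔ Sem I h τ.store τ.globals γ M

theorem SemEq.refl (I : Interp.{u, w} S) (σ : CHRState S U Var) : SemEq I σ σ := by
  obtain ⟨n, g, hg⟩ := exists_family σ.goal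
  exact .inr ⟨n, g, g, hg, hg, fun _ _ => Iff.rfl⟩

theorem SemEq.symm {I : Interp.{u, w} S} {σ τ : CHRState S U Var} (h : SemEq I σ τ) :
    SemEq I τ σ := by
  obtain ⟨h1, h2⟩ | ⟨n, g, h, hg, hh, e⟩ := h
  · exact .inl ⟨h2, h1⟩
  · exact .inr ⟨n, h, g, hh, hg, fun γ M => (e γ M).symm⟩

theorem SemEq.sat {I : Interp.{u, w} S} {σ τ : CHRState S U Var} (h : SemEq I σ τ)
    (hσ : ∃ α, StoreHolds I α σ.store) : ∃ α, StoreHolds I α τ.store := by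
  obtain ⟨h1, h2⟩ | ⟨n, g, h, hg, hh, e⟩ := h
  · exact absurd hσ.choose_spec (h1 _)
  · obtain ⟨α, hα⟩ := hσ
    obtain ⟨β, _, hβ, _⟩ := (e α _).1 ⟨α, fun _ _ => rfl, hα, fun _ => rfl⟩
    exact ⟨β, hβ⟩

/-- Two presentations of one multiset differ by a bijection, so the matching can be pulled back to
any chosen index type. Satisfiability excludes failed states, whose goals may be unrelated. -/
theorem SemEq.exists_family {I : Interp.{u, w} S} {σ τ : CHRState S U Var} (h : SemEq I σ τ)
    (hσ : ∃ α, StoreHolds I α σ.store) {ι : Type*} [Fintype ι] (g : ι → UserConstraint S U Var)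
    (hg : Finset.univ.val.map g = σ.goal) :
    ∃ h : ι → UserConstraint S U Var, Finset.univ.val.map h = τ.goal ∧
      ∀ γ M, Sem I g σ.store σ.globals γ M ↔ Sem I h τ.store τ.globals γ M := by
  obtain ⟨h1, h2⟩ | ⟨n, g', h, hg', hh, e⟩ := h
  · exact absurd hσ.choose_spec (h1 _)
  · obtain ⟨φ, hφ⟩ := exists_equiv_of_map_univ_eq (hg.trans hg'.symm)
    refine ⟨fun i => h (φ i), by rw [map_univ_comp_equiv, hh], fun γ M => ?_⟩
    have : g = fun i => g' (φ i) := funext fun i => (hφ i).symm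
    rw [this, sem_comp_equiv, sem_comp_equiv, e]

/-- The two hypotheses may present the middle goal differently, so the second is re-indexed along
the first. If `σ` is unsatisfiable, so is `υ`, since satisfiability passes both ways. -/
theorem SemEq.trans {I : Interp.{u, w} S} {σ τ υ : CHRState S U Var} (h₁ : SemEq I σ τ)
    (h₂ : SemEq I τ υ) : SemEq I σ υ := by
  by_cases hσ : ∃ α, StoreHolds I α σ.store
  · have hτ := h₁.sat hσ
    obtain ⟨n, g, hg⟩ := _root_.exists_family σ.goal
    obtain ⟨h, hh, e⟩ := h₁.exists_family hσ g hg
    obtain ⟨k, hk, e'⟩ := h₂.exists_family hτ h hh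
    exact .inr ⟨n, g, k, hg, hk, fun γ M => (e γ M).trans (e' γ M)⟩
  · refine .inl ⟨not_exists.1 hσ, not_exists.1 fun h => hσ ?_⟩
    exact h₁.symm.sat (h₂.symm.sat h)

/-- Variables outside the store do not affect its truth, so one may quantify over everything except
the globals and the goal variables. The quantified set then no longer depends on the store. -/
theorem existsHolds_strictlyLocal (I : Interp.{u, w} S) (α : Var → I.Carrier)
    (G : Goal S U Var) (B : Store S Var) (V : Finset Var) :
    ExistsHolds I α (strictlyLocal G B V) B ↔
      ∃ β : Var → I.Carrier, (∀ x, x ∈ V ∨ x ∈ goalVars G → β x = α x) ∧ StoreHolds I β B := by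
  classical
  constructor
  · rintro ⟨β, h, hB⟩
    exact ⟨β, fun x hx => h x fun hl => hx.elim hl.2.1 hl.2.2, hB⟩
  · rintro ⟨β, h, hB⟩
    refine ⟨fun x => if x ∈ strictlyLocal G B V then β x else α x, fun x hx => if_neg hx, ?_⟩
    refine (storeHolds_congr I B fun x hx => ?_).2 hB
    by_cases hl : x ∈ strictlyLocal G B V
    · rw [if_pos hl]
    · rw [if_neg hl, h x]
      by_contra hn
      push Not at hn
      exact hl ⟨hx, hn.1, hn.2⟩

/-- Soundness of the generators: the first three keep the attainable values of the goal, and the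
last relates unsatisfiable states. -/
theorem EquivGenerator.semEq {CT : ConstraintTheory.{u, w} S} {σ τ : CHRState S U Var}
    (h : EquivGenerator CT σ τ) : SemEq CT.toInterp σ τ := by
  classical
  cases h with
  | substitution G B V x t =>
    obtain ⟨n, g, hg⟩ := exists_family G
    refine .inr ⟨n, g, fun i => (g i).subst (Function.update Term.var x t), hg, ?_, fun γ M => ?_⟩
    · rw [← hg]
      simp only [goalSubst, Multiset.map_map, Function.comp_def]
    · refine exists_congr fun α => and_congr_right fun _ => and_congr_right fun hB => ?_
      refine forall_congr' fun i => ?_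
      rw [UserConstraint.ground_subst]
      have hx : α x = t.eval CT.toInterp α :=
        hB (Builtin.eq (.var x) t) (by simp)
      -- A solution of `x ≐ t` is unchanged by precomposing with the substitution of `t` for `x`.
      have : (fun y => (Function.update Term.var x t y).eval CT.toInterp α) = α := by
        funext y
        by_cases hy : y = x
        · subst hy; simp [hx]
        · simp [hy, Term.eval]
      rw [this]
  | transformation G B₁ B₂ V h =>
    obtain ⟨n, g, hg⟩ := exists_family G
    refine .inr ⟨n, g, g, hg, hg, fun γ M => ?_⟩
    simp only [existsHolds_strictlyLocal] at h
    have key : ∀ B₁ B₂ : Store S Var, (∀ α : Var → CT.Carrier, (∃ β : Var → CT.Carrier,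
        (∀ x, x ∈ V ∨ x ∈ goalVars G → β x = α x) ∧ StoreHolds CT.toInterp β B₁) →
        ∃ β : Var → CT.Carrier,
        (∀ x, x ∈ V ∨ x ∈ goalVars G → β x = α x) ∧ StoreHolds CT.toInterp β B₂) →
        Sem CT.toInterp g B₁ V γ M → Sem CT.toInterp g B₂ V γ M := by
      rintro B₁ B₂ h ⟨α, hV, hB, hM⟩
      obtain ⟨β, hβ, hB'⟩ := h α ⟨α, fun _ _ => rfl, hB⟩
      refine ⟨β, fun x hx => (hβ x (.inl hx)).trans (hV x hx), hB', fun i => ?_⟩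
      rw [← hM i]
      exact ground_congr_of_goalVars _ hg (fun x hx => hβ x (.inr hx)) i
    exact ⟨key _ _ fun α => (h α).1, key _ _ fun α => (h α).2⟩
  | omission G B V x hG hB =>
    obtain ⟨n, g, hg⟩ := exists_family G
    refine .inr ⟨n, g, g, hg, hg, fun γ M => ⟨?_, ?_⟩⟩
    · rintro ⟨α, hV, h⟩
      exact ⟨α, fun y hy => hV y (Finset.mem_insert_of_mem hy), h⟩
    · rintro ⟨α, hV, h, hM⟩
      -- As `x` occurs nowhere, its value can be reset to the one demanded by `γ`.
      have hne : ∀ y, y ≠ x → Function.update α x (γ x) y = α y := fun y hy => by simp [hy]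
      refine ⟨Function.update α x (γ x), fun y hy => ?_, ?_, fun i => ?_⟩
      · by_cases hyx : y = x
        · subst hyx; simp
        · rw [hne y hyx]; exact hV y (Finset.mem_of_mem_insert_of_ne hy hyx)
      · exact (storeHolds_congr _ B fun y hy => hne y fun e => hB (e ▸ hy)).2 h
      · rw [← hM i]
        exact ground_congr_of_goalVars _ hg (fun y hy => hne y fun e => hG (e ▸ hy)) i
  | failed G₁ G₂ V =>
    have : ∀ α, ¬ StoreHolds CT.toInterp α ({Builtin.bot} : Store S Var) :=
      fun α h => h Builtin.bot (by simp)
    exact .inl ⟨this, this⟩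

theorem StateEquiv.semEq {CT : ConstraintTheory.{u, w} S} {σ τ : CHRState S U Var}
    (h : StateEquiv CT σ τ) : SemEq CT.toInterp σ τ := by
  induction h with
  | rel _ _ h => exact h.semEq
  | refl => exact SemEq.refl _ _
  | symm _ _ _ ih => exact ih.symm
  | trans _ _ _ _ _ ih₁ ih₂ => exact ih₁.trans ih₂

end Semantics

/-! ### Completeness: states with equal values are equivalent. -/

section Completeness

variable {S : BuiltinSig.{u}} {U : UserSig} {Var : Type v} {CT : ConstraintTheory.{u, w} S}

theorem StateEquiv.refl (σ : CHRState S U Var) : StateEquiv CT σ σ := Relation.EqvGen.refl σ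

theorem StateEquiv.symm {σ τ : CHRState S U Var} (h : StateEquiv CT σ τ) : StateEquiv CT τ σ :=
  Relation.EqvGen.symm _ _ h

theorem StateEquiv.trans {σ τ υ : CHRState S U Var} (h₁ : StateEquiv CT σ τ)
    (h₂ : StateEquiv CT τ υ) : StateEquiv CT σ υ :=
  Relation.EqvGen.trans _ _ _ h₁ h₂

/-- The store `B` has a solution with the values of `γ` on `V` and those of `α` on the variables
of the goal. -/
def Solvable (I : Interp.{u, w} S) (G : Goal S U Var) (B : Store S Var) (V : Finset Var)
    (γ α : Var → I.Carrier) : Prop :=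
  ∃ β : Var → I.Carrier, (∀ x ∈ V, β x = γ x) ∧ (∀ x ∈ goalVars G, β x = α x) ∧ StoreHolds I β B

/-- Only the diagonal `γ = α` is needed for the generator; keeping the two valuations apart fits
`Sem`, where globals and goal values are prescribed independently. -/
theorem StateEquiv.of_store {G : Goal S U Var} {B₁ B₂ : Store S Var} {V : Finset Var}
    (h : ∀ γ α, Solvable CT.toInterp G B₁ V γ α ↔ Solvable CT.toInterp G B₂ V γ α) :
    StateEquiv CT ⟨G, B₁, V⟩ ⟨G, B₂, V⟩ :=
  .rel _ _ (.transformation G B₁ B₂ V fun α => by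
    simpa only [existsHolds_strictlyLocal, or_imp, forall_and, and_assoc, Solvable] using h α α)

theorem StateEquiv.omit_global {G : Goal S U Var} {B : Store S Var} {V : Finset Var} {x : Var}
    (hG : x ∉ goalVars G) (hB : x ∉ storeVars B) [DecidableEq Var] :
    StateEquiv CT ⟨G, B, insert x V⟩ ⟨G, B, V⟩ := by
  have := EquivGenerator.omission (CT := CT) G B V x hG hB
  unfold StateEquiv
  convert Relation.EqvGen.rel _ _ this

/-- Each side reduces to the failed state with empty goal and no globals: turn the store into `⊥`,
discard the goal, then omit the globals, which no longer occur. -/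
theorem StateEquiv.of_unsat {σ τ : CHRState S U Var}
    (hσ : ∀ α, ¬ StoreHolds CT.toInterp α σ.store)
    (hτ : ∀ α, ¬ StoreHolds CT.toInterp α τ.store) : StateEquiv CT σ τ := by
  classical
  have hbot : ∀ α, ¬ StoreHolds CT.toInterp α ({Builtin.bot} : Store S Var) :=
    fun α h => h Builtin.bot (by simp)
  have key : ∀ σ : CHRState S U Var, (∀ α, ¬ StoreHolds CT.toInterp α σ.store) →
      StateEquiv CT σ ⟨0, {Builtin.bot}, ∅⟩ := by
    rintro ⟨G, B, V⟩ h
    have h1 : StateEquiv CT ⟨G, B, V⟩ ⟨G, {Builtin.bot}, V⟩ := StateEquiv.of_store fun γ α =>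
      ⟨fun ⟨β, _, _, hβ⟩ => absurd hβ (h β), fun ⟨β, _, _, hβ⟩ => absurd hβ (hbot β)⟩
    refine h1.trans (.trans (.rel _ _ (.failed G 0 V)) ?_)
    clear h h1
    induction V using Finset.induction_on with
    | empty => exact .refl _
    | insert x V _ ih =>
      refine .trans (StateEquiv.omit_global ?_ ?_) ih
      · simp [goalVars]
      · simp [storeVars, Builtin.vars]
  exact (key σ hσ).trans (key τ hτ).symm

/-- A local variable that does not occur in the goal can be made a fresh global one. -/
theorem exists_stateEquiv_insert_global [Infinite Var] [DecidableEq Var] {G : Goal S U Var}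
    (B : Store S Var) {V : Finset Var} {x : Var} (hV : x ∉ V) (hG : x ∉ goalVars G) :
    ∃ B' : Store S Var, StateEquiv CT ⟨G, B, V⟩ ⟨G, B', insert x V⟩ ∧
      ∀ γ α, Solvable CT.toInterp G B V γ α ↔ Solvable CT.toInterp G B' (insert x V) γ α := by
  have hfin : (storeVars B ∪ goalVars G ∪ ↑V ∪ {x}).Finite :=
    (((storeVars_finite B).union (goalVars_finite G)).union V.finite_toSet).union
      (Set.finite_singleton x)
  -- The store may contain `x` as a local variable. Swapping it with a fresh `y` frees the name, and
  -- `x` can then be added by reversing the omission rule.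
  obtain ⟨y, hy⟩ := hfin.infinite_compl.nonempty
  simp only [Set.mem_compl_iff, Set.mem_union, Set.mem_singleton_iff, not_or, Finset.mem_coe] at hy
  obtain ⟨⟨⟨hyB, hyG⟩, hyV⟩, hyx⟩ := hy
  have hfixV : ∀ z ∈ V, Equiv.swap x y z = z := fun z hz =>
    Equiv.swap_apply_of_ne_of_ne (fun e => hV (e ▸ hz)) (fun e => hyV (e ▸ hz))
  have hfixG : ∀ z ∈ goalVars G, Equiv.swap x y z = z := fun z hz =>
    Equiv.swap_apply_of_ne_of_ne (fun e => hG (e ▸ hz)) (fun e => hyG (e ▸ hz))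
  have hxB : x ∉ storeVars (storeRename (Equiv.swap x y) B) := by
    rw [storeVars_rename]
    rintro ⟨z, hz, e⟩
    rw [Equiv.swap_apply_eq_iff, Equiv.swap_apply_left] at e
    exact hyB (e ▸ hz)
  have hren : ∀ γ α, Solvable CT.toInterp G B V γ α ↔
      Solvable CT.toInterp G (storeRename (Equiv.swap x y) B) V γ α := fun γ α => by
    constructor
    · rintro ⟨β, hβ, hβ', hB⟩
      refine ⟨β ∘ Equiv.swap x y, fun z hz => by simp [hfixV z hz, hβ z hz],
        fun z hz => by simp [hfixG z hz, hβ' z hz], ?_⟩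
      rw [storeHolds_rename]
      convert hB using 1
      funext z
      simp
    · rintro ⟨β, hβ, hβ', hB⟩
      rw [storeHolds_rename] at hB
      exact ⟨β ∘ Equiv.swap x y, fun z hz => by simp [hfixV z hz, hβ z hz],
        fun z hz => by simp [hfixG z hz, hβ' z hz], hB⟩
  refine ⟨storeRename (Equiv.swap x y) B, .trans (.of_store hren)
    (StateEquiv.omit_global hG hxB).symm, fun γ α => (hren γ α).trans ⟨?_, ?_⟩⟩
  · rintro ⟨β, hβ, hβ', hB⟩
    have hne : ∀ z, z ≠ x → Function.update β x (γ x) z = β z := fun z hz => by simp [hz]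
    refine ⟨Function.update β x (γ x), fun z hz => ?_, fun z hz => ?_, ?_⟩
    · by_cases hzx : z = x
      · subst hzx; simp
      · rw [hne z hzx]; exact hβ z (Finset.mem_of_mem_insert_of_ne hz hzx)
    · rw [hne z fun e => hG (e ▸ hz)]; exact hβ' z hz
    · exact (storeHolds_congr _ _ fun z hz => hne z (by rintro rfl; exact hxB hz)).2 hB
  · rintro ⟨β, hβ, h⟩
    exact ⟨β, fun z hz => hβ z (Finset.mem_insert_of_mem hz), h⟩

/-- This serves to give two states the same set of globals, so that they can be compared by a
transformation of the store. -/
theorem exists_stateEquiv_union_globals [Infinite Var] [DecidableEq Var] {G : Goal S U Var}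
    (B : Store S Var) (V W : Finset Var) (hG : ∀ x ∈ W, x ∉ goalVars G) :
    ∃ B' : Store S Var, StateEquiv CT ⟨G, B, V⟩ ⟨G, B', W ∪ V⟩ ∧
      ∀ γ α, Solvable CT.toInterp G B V γ α ↔ Solvable CT.toInterp G B' (W ∪ V) γ α := by
  induction W using Finset.induction_on with
  | empty => exact ⟨B, by rw [Finset.empty_union]; exact ⟨.refl _, fun _ _ => Iff.rfl⟩⟩
  | insert x W _ ih =>
    obtain ⟨B', h, hs⟩ := ih fun y hy => hG y (Finset.mem_insert_of_mem hy)
    rw [Finset.insert_union]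
    by_cases hx : x ∈ W ∪ V
    · exact ⟨B', by rw [Finset.insert_eq_of_mem hx]; exact ⟨h, hs⟩⟩
    · obtain ⟨B'', h', hs'⟩ := exists_stateEquiv_insert_global (CT := CT) B' hx
        (hG x (Finset.mem_insert_self x W))
      exact ⟨B'', h.trans h', fun γ α => (hs γ α).trans (hs' γ α)⟩

open Classical in
/-- The goal `g` with the arguments at the positions satisfying `s` replaced by the variables `z`. -/
noncomputable def abstractArgs {ι : Type*} (z : ι × ℕ → Var) (s : ι × ℕ → Prop)
    (g : ι → UserConstraint S U Var) (i : ι) : UserConstraint S U Var :=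
  ⟨(g i).sym, fun j => if s (i, j) then .var (z (i, j)) else (g i).args j⟩

/-- The equations between the variables `z` and the arguments of `g`. -/
def argEqs {ι : Type*} [Fintype ι] (z : ι × ℕ → Var) (g : ι → UserConstraint S U Var) :
    Store S Var :=
  Finset.univ.val.map fun p : Σ i, Fin (U.arity (g i).sym) =>
    Builtin.eq (.var (z (p.1, p.2))) ((g p.1).args p.2)

/-- The goal that consists of the symbols of `g` applied to the variables `z`. -/
def flatGoal {ι : Type*} (z : ι × ℕ → Var) (g : ι → UserConstraint S U Var) (i : ι) :
    UserConstraint S U Var :=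
  ⟨(g i).sym, fun j => .var (z (i, j))⟩

theorem storeHolds_argEqs {I : Interp.{u, w} S} {ι : Type*} [Fintype ι] {z : ι × ℕ → Var}
    {g : ι → UserConstraint S U Var} {α : Var → I.Carrier} :
    StoreHolds I α (argEqs z g) ↔
      ∀ i (j : Fin (U.arity (g i).sym)), α (z (i, j)) = ((g i).args j).eval I α := by
  simp only [StoreHolds, argEqs, Multiset.forall_mem_map_iff, Finset.mem_val, Finset.mem_univ,
    forall_true_left, Sigma.forall]
  rfl

/-- A solution can be changed on fresh variables to satisfy the equations `argEqs`. -/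
theorem exists_argEqs_solution {I : Interp.{u, w} S} {ι : Type*} [Fintype ι] {z : ι × ℕ → Var}
    (hz : Function.Injective z) {g : ι → UserConstraint S U Var}
    (hg : ∀ p, z p ∉ goalVars (Finset.univ.val.map g)) (α : Var → I.Carrier) :
    ∃ β : Var → I.Carrier, (∀ x, x ∉ Set.range z → β x = α x) ∧
      StoreHolds I β (argEqs z g) := by
  classical
  refine ⟨Function.extend z (fun p => if h : p.2 < U.arity (g p.1).sym then
    ((g p.1).args ⟨p.2, h⟩).eval I α else α (z p)) α, fun x hx => ?_, ?_⟩
  · exact Function.extend_apply' _ _ _ fun ⟨p, hp⟩ => hx ⟨p, hp⟩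
  · rw [storeHolds_argEqs]
    intro i j
    rw [hz.extend_apply]
    simp only [Fin.is_lt, dif_pos, Fin.eta]
    refine Term.eval_congr _ _ fun x hx => ?_
    rw [Function.extend_apply']
    rintro ⟨p, rfl⟩
    exact hg p (mem_goalVars.2 ⟨i, Set.mem_iUnion.2 ⟨j, hx⟩⟩)

/-- Every state is equivalent to one whose goal has pairwise distinct fresh variables as
arguments. -/
theorem stateEquiv_flat {ι : Type*} [Fintype ι] {z : ι × ℕ → Var}
    (hz : Function.Injective z) {g : ι → UserConstraint S U Var} {B : Store S Var}
    {V : Finset Var} (hg : ∀ p, z p ∉ goalVars (Finset.univ.val.map g))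
    (hB : ∀ p, z p ∉ storeVars B) (hV : ∀ p, z p ∉ V) :
    StateEquiv CT ⟨Finset.univ.val.map g, B, V⟩
      ⟨Finset.univ.val.map (flatGoal z g), argEqs z g + B, V⟩ := by
  classical
  -- Adding the equations is conservative, since the variables `z` are fresh and can be set to the
  -- values of the arguments.
  have h0 : StateEquiv CT ⟨Finset.univ.val.map g, B, V⟩
      ⟨Finset.univ.val.map g, argEqs z g + B, V⟩ := by
    refine .of_store fun γ α => ⟨?_, ?_⟩
    · rintro ⟨β, hβ, hβ', h⟩
      obtain ⟨δ, hδ, hδ'⟩ := exists_argEqs_solution hz hg β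
      refine ⟨δ, fun x hx => ?_, fun x hx => ?_, (storeHolds_add _ _ _ _).2 ⟨hδ', ?_⟩⟩
      · rw [hδ, hβ x hx]; rintro ⟨p, rfl⟩; exact hV p hx
      · rw [hδ, hβ' x hx]; rintro ⟨p, rfl⟩; exact hg p hx
      · refine (storeHolds_congr _ _ fun x hx => ?_).2 h
        rw [hδ]; rintro ⟨p, rfl⟩; exact hB p hx
    · rintro ⟨β, hβ, hβ', h⟩
      exact ⟨β, hβ, hβ', ((storeHolds_add _ _ _ _).1 h).2⟩
  -- The arguments are abstracted one position at a time. Each step is the substitution rule read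
  -- backwards: replacing the variable of the new position by its argument restores the previous
  -- goal.
  have h1 : ∀ s : Finset (Σ i, Fin (U.arity (g i).sym)),
      StateEquiv CT ⟨Finset.univ.val.map g, argEqs z g + B, V⟩
        ⟨Finset.univ.val.map
          (abstractArgs z (fun p => ∃ q ∈ s, p = (q.1, (q.2 : ℕ))) g), argEqs z g + B, V⟩ := by
    intro s
    induction s using Finset.induction_on with
    | empty =>
      have : abstractArgs z (fun p => ∃ q ∈ (∅ : Finset (Σ i, Fin (U.arity (g i).sym))),
          p = (q.1, (q.2 : ℕ))) g = g := by
        funext i; simp [abstractArgs]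
      rw [this]
      exact .refl _
    | insert q s hq ih =>
      refine ih.trans (.symm ?_)
      obtain ⟨C, hC⟩ := Multiset.exists_cons_of_mem (s := argEqs z g)
        (a := Builtin.eq (.var (z (q.1, q.2))) ((g q.1).args q.2))
        (Multiset.mem_map.2 ⟨q, Finset.mem_univ q, rfl⟩)
      have hC' : argEqs z g + B =
          {Builtin.eq (.var (z (q.1, q.2))) ((g q.1).args q.2)} + (C + B) := by
        rw [hC, ← Multiset.singleton_add, add_assoc]
      rw [hC']
      have := EquivGenerator.substitution (CT := CT) (Finset.univ.val.map
        (abstractArgs z (fun p => ∃ q' ∈ insert q s, p = (q'.1, (q'.2 : ℕ))) g)) (C + B) V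
        (z (q.1, q.2)) ((g q.1).args q.2)
      unfold StateEquiv
      convert Relation.EqvGen.rel _ _ this using 2
      simp only [goalSubst, Multiset.map_map]
      refine Multiset.map_congr rfl fun i _ => ?_
      simp only [abstractArgs, UserConstraint.subst, Function.comp]
      congr 1
      funext j
      by_cases hij : (⟨i, j⟩ : Σ i, Fin (U.arity (g i).sym)) = q
      · subst hij
        have h1 : ¬ ∃ q' ∈ s, (i, (j : ℕ)) = (q'.1, (q'.2 : ℕ)) := by
          rintro ⟨⟨i', j'⟩, hq', e⟩
          simp only [Prod.mk.injEq] at e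
          obtain ⟨rfl, e⟩ := e
          rw [← Fin.ext_iff] at e
          exact hq (e ▸ hq')
        rw [if_neg h1, if_pos ⟨_, Finset.mem_insert_self _ _, rfl⟩]
        simp [Term.subst]
      · have h1 : (∃ q' ∈ insert q s, (i, (j : ℕ)) = (q'.1, (q'.2 : ℕ))) ↔
            ∃ q' ∈ s, (i, (j : ℕ)) = (q'.1, (q'.2 : ℕ)) := by
          constructor
          · rintro ⟨q', hq', e⟩
            refine ⟨q', (Finset.mem_insert.1 hq').resolve_left ?_, e⟩
            rintro rfl
            obtain ⟨i', j'⟩ := q'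
            simp only [Prod.mk.injEq] at e
            obtain ⟨rfl, e⟩ := e
            rw [← Fin.ext_iff] at e
            exact hij (e ▸ rfl)
          · rintro ⟨q', hq', e⟩
            exact ⟨q', Finset.mem_insert_of_mem hq', e⟩
        by_cases h2 : ∃ q' ∈ s, (i, (j : ℕ)) = (q'.1, (q'.2 : ℕ))
        · rw [if_pos h2, if_pos (h1.2 h2)]
          simp only [Term.subst]
          rw [Function.update_of_ne]
          intro e
          have e := hz e
          obtain ⟨i', j'⟩ := q
          simp only [Prod.mk.injEq] at e
          obtain ⟨rfl, e⟩ := e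
          rw [← Fin.ext_iff] at e
          exact hij (e ▸ rfl)
        · rw [if_neg h2, if_neg (mt h1.1 h2)]
          refine (Term.subst_eq_self _ fun x hx => ?_).symm
          rw [Function.update_of_ne]
          rintro rfl
          exact hg _ (mem_goalVars.2 ⟨i, Set.mem_iUnion.2 ⟨j, hx⟩⟩)
  refine h0.trans ((h1 Finset.univ).trans ?_)
  have : abstractArgs z (fun p => ∃ q ∈ (Finset.univ : Finset (Σ i, Fin (U.arity (g i).sym))),
      p = (q.1, (q.2 : ℕ))) g = flatGoal z g := by
    funext i
    simp only [abstractArgs, flatGoal]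
    congr 1
    funext j
    exact if_pos ⟨⟨i, j⟩, Finset.mem_univ _, rfl⟩
  rw [this]
  exact .refl _

theorem goalVars_flatGoal {ι : Type*} [Fintype ι] {z : ι × ℕ → Var}
    {g : ι → UserConstraint S U Var} {x : Var}
    (hx : x ∈ goalVars (Finset.univ.val.map (flatGoal z g))) :
    ∃ i, ∃ j : Fin (U.arity (g i).sym), x = z (i, j) := by
  obtain ⟨i, hi⟩ := mem_goalVars.1 hx
  obtain ⟨j, hj⟩ := Set.mem_iUnion.1 hi
  exact ⟨i, j, hj⟩

/-- In a flat goal, prescribing the values of the goal variables is the same as prescribing the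
values of the constraints; the equations transfer these values to the original arguments. -/
theorem solvable_flat {I : Interp.{u, w} S} {ι : Type*} [Fintype ι] {z : ι × ℕ → Var}
    (hz : Function.Injective z) {g : ι → UserConstraint S U Var} {B : Store S Var}
    {V : Finset Var} (hg : ∀ p, z p ∉ goalVars (Finset.univ.val.map g))
    (hB : ∀ p, z p ∉ storeVars B) (hV : ∀ p, z p ∉ V) (γ α : Var → I.Carrier) :
    Solvable I (Finset.univ.val.map (flatGoal z g)) (argEqs z g + B) V γ α ↔
      Sem I g B V γ fun i => (flatGoal z g i).ground I α := by
  constructor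
  · rintro ⟨β, hβ, hβ', h⟩
    rw [storeHolds_add, storeHolds_argEqs] at h
    refine ⟨β, hβ, h.2, fun i => ?_⟩
    simp only [UserConstraint.ground, flatGoal, ← h.1, Term.eval]
    congr 2
    funext j
    exact hβ' _ (mem_goalVars.2 ⟨i, Set.mem_iUnion.2 ⟨j, rfl⟩⟩)
  · rintro ⟨β, hβ, h, hM⟩
    obtain ⟨δ, hδ, hδ'⟩ := exists_argEqs_solution hz hg β
    refine ⟨δ, fun x hx => ?_, fun x hx => ?_, (storeHolds_add _ _ _ _).2 ⟨hδ', ?_⟩⟩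
    · rw [hδ, hβ x hx]; rintro ⟨p, rfl⟩; exact hV p hx
    · obtain ⟨i, j, rfl⟩ := goalVars_flatGoal hx
      rw [storeHolds_argEqs] at hδ'
      rw [hδ']
      have := hM i
      simp only [UserConstraint.ground, flatGoal, Term.eval, Prod.mk.injEq, true_and,
        List.ofFn_inj] at this
      rw [← congrFun this j]
      refine Term.eval_congr _ _ fun x hx => hδ _ ?_
      rintro ⟨p, rfl⟩
      exact hg p (mem_goalVars.2 ⟨i, Set.mem_iUnion.2 ⟨j, hx⟩⟩)
    · refine (storeHolds_congr _ _ fun x hx => ?_).2 h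
      rw [hδ]; rintro ⟨p, rfl⟩; exact hB p hx

theorem exists_fresh [Infinite Var] (ι : Type*) [Countable ι] {F : Set Var} (hF : F.Finite) :
    ∃ z : ι → Var, Function.Injective z ∧ ∀ i, z i ∉ F := by
  obtain ⟨f, hf⟩ := exists_injective_nat ι
  let e := Set.Infinite.natEmbedding _ hF.infinite_compl
  exact ⟨fun i => e (f i), fun i j h => hf (e.injective (Subtype.ext h)), fun i => (e (f i)).2⟩

/-- States that take the same values are equivalent. -/
theorem StateEquiv.of_sem [Infinite Var] {ι : Type*} [Fintype ι]
    {g h : ι → UserConstraint S U Var} {B₁ B₂ : Store S Var} {V₁ V₂ : Finset Var}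
    (e : ∀ γ M, Sem CT.toInterp g B₁ V₁ γ M ↔ Sem CT.toInterp h B₂ V₂ γ M) :
    StateEquiv CT ⟨Finset.univ.val.map g, B₁, V₁⟩ ⟨Finset.univ.val.map h, B₂, V₂⟩ := by
  classical
  by_cases hsat : ∃ α, StoreHolds CT.toInterp α B₁
  · obtain ⟨α, hα⟩ := hsat
    -- A value attained by `g` is attained by `h`, and it records the symbol.
    have hsym : ∀ i, (g i).sym = (h i).sym := fun i => by
      obtain ⟨β, _, _, hβ⟩ := (e α _).1 ⟨α, fun _ _ => rfl, hα, fun _ => rfl⟩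
      exact (congrArg Prod.fst (hβ i)).symm
    -- The index type does not depend on the arities, so the same variables flatten both goals, and
    -- the flat goals coincide.
    obtain ⟨z, hz, hzF⟩ := exists_fresh (Var := Var) (ι × ℕ)
      ((((goalVars_finite (Finset.univ.val.map g)).union
        (goalVars_finite (Finset.univ.val.map h))).union
        ((storeVars_finite B₁).union (storeVars_finite B₂))).union
        ((V₁ ∪ V₂).finite_toSet))
    simp only [Set.mem_union, not_or, Finset.coe_union, Finset.mem_coe] at hzF
    have hflat : flatGoal z g = flatGoal z h := by
      funext i
      simp only [flatGoal]
      have := hsym i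
      revert this
      generalize (g i).sym = a
      generalize (h i).sym = b
      rintro rfl
      rfl
    have s₁ := stateEquiv_flat (CT := CT) hz (fun p => (hzF p).1.1.1) (fun p => (hzF p).1.2.1)
      (fun p => (hzF p).2.1)
    have s₂ := stateEquiv_flat (CT := CT) hz (fun p => (hzF p).1.1.2) (fun p => (hzF p).1.2.2)
      (fun p => (hzF p).2.2)
    have hW : ∀ W : Finset Var, (∀ p, z p ∉ W) →
        ∀ x ∈ W, x ∉ goalVars (Finset.univ.val.map (flatGoal z g)) := by
      intro W hW x hx hx'
      obtain ⟨i, j, rfl⟩ := goalVars_flatGoal hx'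
      exact hW _ hx
    -- Each state receives the globals of the other; these do not occur in the flat goal, whose
    -- arguments are fresh.
    obtain ⟨C₁, t₁, q₁⟩ := exists_stateEquiv_union_globals (CT := CT) (argEqs z g + B₁) V₁ V₂
      (hW V₂ fun p => (hzF p).2.2)
    obtain ⟨C₂, t₂, q₂⟩ := exists_stateEquiv_union_globals (CT := CT) (argEqs z h + B₂) V₂ V₁
      (hW V₁ fun p => (hzF p).2.1)
    refine s₁.trans (t₁.trans (.symm (s₂.trans ?_)))
    rw [← hflat]
    refine t₂.trans ?_
    rw [Finset.union_comm V₁ V₂]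
    refine .of_store fun γ α => ?_
    rw [← q₁, Finset.union_comm V₂ V₁, ← q₂,
      solvable_flat hz (fun p => (hzF p).1.1.1) (fun p => (hzF p).1.2.1) (fun p => (hzF p).2.1),
      e, hflat,
      solvable_flat hz (fun p => (hzF p).1.1.2) (fun p => (hzF p).1.2.2) (fun p => (hzF p).2.2)]
  · refine .of_unsat (not_exists.1 hsat) (not_exists.1 fun ⟨α, hα⟩ => hsat ?_)
    obtain ⟨β, _, hβ, _⟩ := (e α _).2 ⟨α, fun _ _ => rfl, hα, fun _ => rfl⟩
    exact ⟨β, hβ⟩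

end Completeness

/-! ### Graph encodings as sets of values. -/

section GraphValues

variable {S : BuiltinSig.{u}} {Var : Type v} {TG : FinGraph} {CT : ConstraintTheory.{u, w} S}

/-- The values of the elements of a graph, with identifiers `a`, `b` and node labels `d`. -/
def graphVal {C : Type w} (G : TypedGraph TG) (a d : G.V → C) (b : G.E → C) :
    G.V ⊕ G.E → (TG.V ⊕ TG.E) × List C :=
  Sum.elim (fun v => (.inl (G.type.onV v), [a v, d v]))
    (fun e => (.inr (G.type.onE e), [b e, a (G.src e), a (G.tgt e)]))

/-- The degrees of the nodes of a graph as elements of the constraint structure. -/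
noncomputable def degVal (CT : ConstraintTheory.{u, w} S) (G : TypedGraph TG) (v : G.V) :
    CT.Carrier :=
  CT.num (G.deg v)

/-- Among the values in `Q`, those with the node degrees of `G` are the encodings of `G`. -/
def Encodes (CT : ConstraintTheory.{u, w} S) (G : TypedGraph TG)
    (Q : (G.V ⊕ G.E → (TG.V ⊕ TG.E) × List CT.Carrier) → Prop) : Prop :=
  (∀ a b, Q (graphVal G a (degVal CT G) b)) ∧
    ∀ M, Q M → (∀ v, ∃ s c, M (.inl v) = (s, [c, degVal CT G v])) →
      ∃ a b, M = graphVal G a (degVal CT G) b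

/-- Under suitable degrees, the goal of the state is the encoding of a graph. -/
def EncodesGraph (CT : ConstraintTheory.{u, w} S) (σ : CHRState S (graphSig TG) Var) : Prop :=
  ∃ (G : TypedGraph TG) (g : G.V ⊕ G.E → UserConstraint S (graphSig TG) Var),
    Finset.univ.val.map g = σ.goal ∧
      Encodes CT G fun M => ∃ γ, Sem CT.toInterp g σ.store σ.globals γ M

theorem Encodes.sat {G : TypedGraph TG} {g : G.V ⊕ G.E → UserConstraint S (graphSig TG) Var}
    {B : Store S Var} {V : Finset Var}
    (h : Encodes CT G fun M => ∃ γ, Sem CT.toInterp g B V γ M) :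
    ∃ α, StoreHolds CT.toInterp α B := by
  obtain ⟨γ, α, _, hα, _⟩ := h.1 (fun _ => CT.num 0) (fun _ => CT.num 0)
  exact ⟨α, hα⟩

/-- The property depends only on the attainable values of a satisfiable state, and these are
invariant after re-indexing the goal. -/
theorem EncodesGraph.congr {σ τ : CHRState S (graphSig TG) Var} (h : StateEquiv CT σ τ)
    (hσ : EncodesGraph CT σ) : EncodesGraph CT τ := by
  obtain ⟨G, g, hg, hG⟩ := hσ
  obtain ⟨k, hk, e⟩ := h.semEq.exists_family hG.sat g hg
  exact ⟨G, k, hk, by simpa only [e] using hG⟩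

theorem UserConstraint.exists_node_args {c : UserConstraint S (graphSig TG) Var} {t : TG.V}
    (h : c.sym = .inl t) : ∃ s₁ s₂ : Term S Var, ∀ α : Var → CT.Carrier,
      c.ground CT.toInterp α = (.inl t, [s₁.eval CT.toInterp α, s₂.eval CT.toInterp α]) := by
  obtain ⟨s, args⟩ := c
  obtain rfl : s = .inl t := h
  exact ⟨args (0 : Fin 2), args (1 : Fin 2), fun α => rfl⟩

theorem UserConstraint.exists_edge_args {c : UserConstraint S (graphSig TG) Var} {t : TG.E}
    (h : c.sym = .inr t) : ∃ s₁ s₂ s₃ : Term S Var, ∀ α : Var → CT.Carrier,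
      c.ground CT.toInterp α = (.inr t, [s₁.eval CT.toInterp α, s₂.eval CT.toInterp α,
        s₃.eval CT.toInterp α]) := by
  obtain ⟨s, args⟩ := c
  obtain rfl : s = .inr t := h
  exact ⟨args (0 : Fin 3), args (1 : Fin 3), args (2 : Fin 3), fun α => rfl⟩

theorem ground_nodeConstraint (α : Var → CT.Carrier) (t : TG.V) (x : Var) (d : Term S Var) :
    (nodeConstraint t x d).ground CT.toInterp α = (.inl t, [α x, d.eval CT.toInterp α]) := rfl

theorem ground_edgeConstraint (α : Var → CT.Carrier) (t : TG.E) (x y z : Var) :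
    (edgeConstraint (S := S) t x y z).ground CT.toInterp α = (.inr t, [α x, α y, α z]) := rfl

/-- The family of constraints that make up `chrGnd G ν`. -/
noncomputable def chrFamily (G : TypedGraph TG) (ν : Naming (G.V ⊕ G.E) Var) :
    G.V ⊕ G.E → UserConstraint S (graphSig TG) Var :=
  Sum.elim (fun v => nodeConstraint (G.type.onV v) (ν.var (.inl v)) (.num (G.deg v)))
    (fun e => edgeConstraint (G.type.onE e) (ν.var (.inr e)) (ν.var (.inl (G.src e)))
      (ν.var (.inl (G.tgt e))))

theorem map_chrFamily (G : TypedGraph TG) (ν : Naming (G.V ⊕ G.E) Var) :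
    Finset.univ.val.map (chrFamily (S := S) G ν) = chrGnd G ν :=
  map_univ_sumElim _ _

/-- Identifiers are distinct unconstrained variables and take arbitrary values, while the degrees
are numerals. -/
theorem sem_chrFamily (G : TypedGraph TG) (ν : Naming (G.V ⊕ G.E) Var) (γ : Var → CT.Carrier)
    (M : G.V ⊕ G.E → (TG.V ⊕ TG.E) × List CT.Carrier) :
    Sem CT.toInterp (chrFamily G ν) 0 ∅ γ M ↔ ∃ a b, M = graphVal G a (degVal CT G) b := by
  constructor
  · rintro ⟨α, _, _, h⟩
    refine ⟨fun v => α (ν.var (.inl v)), fun e => α (ν.var (.inr e)), ?_⟩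
    funext i
    rw [← h i]
    cases i <;> rfl
  · rintro ⟨a, b, rfl⟩
    refine ⟨Function.extend ν.var (Sum.elim a b) γ, by simp, storeHolds_zero _ _, ?_⟩
    rintro (v | e) <;>
      simp [chrFamily, ground_nodeConstraint, ground_edgeConstraint, ν.var_inj.extend_apply,
        graphVal, Term.eval, degVal]

theorem exists_naming [Infinite Var] (X : Type) [Countable X] : Nonempty (Naming X Var) := by
  obtain ⟨z, hz, _⟩ := exists_fresh (Var := Var) (X ⊕ X) Set.finite_empty
  exact ⟨⟨fun x => z (.inl x), fun x => z (.inr x), fun x y h => Sum.inl_injective (hz h),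
    fun x y h => Sum.inr_injective (hz h), fun x y h => Sum.inl_ne_inr (hz h)⟩⟩

end GraphValues

/-! ### The graph invariant for stores of constant and offset equations. -/

section DegreeStores

variable {S : BuiltinSig.{u}} {Var : Type v} {TG : FinGraph} {CT : ConstraintTheory.{u, w} S}

/-- The variables whose value is determined by the equations `X = c` and `X = Y + c₁ - c₂`. -/
inductive Pinned (D : Store S Var) : Var → Prop
  | const {x : Var} {c : Term S Var} (hc : c.IsConst) (h : Builtin.eq (.var x) c ∈ D) : Pinned D x
  | left {x y : Var} {c₁ c₂ : ℤ}
      (h : Builtin.arithEq (.var x) (.minus (.plus (.var y) (.const c₁)) (.const c₂)) ∈ D)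
      (hy : Pinned D y) : Pinned D x
  | right {x y : Var} {c₁ c₂ : ℤ}
      (h : Builtin.arithEq (.var x) (.minus (.plus (.var y) (.const c₁)) (.const c₂)) ∈ D)
      (hx : Pinned D x) : Pinned D y

theorem Term.IsConst.eval_eq {I : Interp.{u, w} S} {c : Term S Var} (hc : c.IsConst)
    (α β : Var → I.Carrier) : c.eval I α = c.eval I β := by
  obtain ⟨n, rfl⟩ | ⟨f, args, hf, rfl⟩ := hc
  · rfl
  · simp only [Term.eval]
    congr 1
    funext i
    exact absurd i.2 (by omega)

theorem holds_offset {I : Interp.{u, w} S} {α : Var → I.Carrier} {x y : Var} {c₁ c₂ : ℤ} :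
    (Builtin.arithEq (.var x) (.minus (.plus (.var y) (.const c₁)) (.const c₂))).Holds I α ↔
      ∃ n, α y = I.num n ∧ α x = I.num (n + c₁ - c₂) := by
  simp only [Builtin.Holds, ArithExp.Evaluates]
  constructor
  · rintro ⟨_, hx, i, j, ⟨k, l, hy, rfl, rfl⟩, rfl, rfl⟩
    exact ⟨k, hy, hx⟩
  · rintro ⟨n, hy, hx⟩
    exact ⟨_, hx, _, _, ⟨_, _, hy, rfl, rfl⟩, rfl, rfl⟩

/-- Values propagate from constants through offset equations in both directions, because numerals
are injective and offsets can be inverted. -/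
theorem Pinned.eq {D : Store S Var} {α β : Var → CT.Carrier}
    (hα : StoreHolds CT.toInterp α D) (hβ : StoreHolds CT.toInterp β D) {x : Var}
    (h : Pinned D x) : α x = β x := by
  induction h with
  | const hc h => exact (hα _ h).trans ((hc.eval_eq α β).trans (hβ _ h).symm)
  | left h _ ih =>
    obtain ⟨n, h1, h2⟩ := holds_offset.1 (hα _ h)
    obtain ⟨m, h3, h4⟩ := holds_offset.1 (hβ _ h)
    obtain rfl : n = m := CT.num_inj (by rw [← h1, ← h3, ih])
    rw [h2, h4]
  | right h _ ih =>
    obtain ⟨n, h1, h2⟩ := holds_offset.1 (hα _ h)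
    obtain ⟨m, h3, h4⟩ := holds_offset.1 (hβ _ h)
    have := CT.num_inj (h2.symm.trans (ih.trans h4))
    rw [h1, h3, show n = m by omega]

/-- A solution of a store of the form `X = c`, `X = Y + c₁ - c₂` can be adapted to further
equations `X = c` by changing the values of pinned variables. -/
theorem exists_solution_pinned {B₀ B : Store S Var} (h₀ : ∀ b ∈ B₀, IsConstEq b ∨ IsOffsetEq b)
    (hB : ∀ b ∈ B, IsConstEq b) {α α₀ : Var → CT.Carrier} (hα : StoreHolds CT.toInterp α B₀)
    (hα₀ : StoreHolds CT.toInterp α₀ (B₀ + B)) :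
    ∃ α', StoreHolds CT.toInterp α' (B₀ + B) ∧ ∀ x, ¬ Pinned (B₀ + B) x → α' x = α x := by
  classical
  -- No equation mixes the two valuations: the variable of a constant equation is pinned, and an
  -- offset equation has both variables pinned or neither. Offset equations lie in `B₀`, which `α`
  -- solves.
  refine ⟨fun x => if Pinned (B₀ + B) x then α₀ x else α x, fun b hb => ?_, fun x hx => if_neg hx⟩
  have hcase : IsConstEq b ∨ (IsOffsetEq b ∧ b ∈ B₀) := by
    obtain h | h := Multiset.mem_add.1 hb
    · exact (h₀ b h).imp_right fun h' => ⟨h', h⟩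
    · exact .inl (hB b h)
  obtain ⟨x, c, hc, rfl⟩ | ⟨⟨x, y, c₁, c₂, rfl⟩, hb₀⟩ := hcase
  · have hx : Pinned (B₀ + B) x := .const hc hb
    have := hα₀ _ hb
    simp only [Builtin.Holds, Term.eval] at this ⊢
    rw [if_pos hx, this]
    exact hc.eval_eq _ _
  · rw [holds_offset]
    by_cases hx : Pinned (B₀ + B) x
    · have hy : Pinned (B₀ + B) y := .right hb hx
      simpa only [if_pos hx, if_pos hy] using holds_offset.1 (hα₀ _ hb)
    · have hy : ¬ Pinned (B₀ + B) y := fun hy => hx (.left hb hy)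
      simpa only [if_neg hx, if_neg hy] using holds_offset.1 (hα _ hb₀)

/-- A term that takes all values does not contain pinned variables. -/
theorem Term.eval_eq_of_pinned {D : Store S Var} {t : Term S Var}
    (ht : ∀ c, ∃ β, StoreHolds CT.toInterp β D ∧ t.eval CT.toInterp β = c)
    {α α' : Var → CT.Carrier} (h : ∀ x, ¬ Pinned D x → α' x = α x) :
    t.eval CT.toInterp α' = t.eval CT.toInterp α := by
  cases t with
  | var x =>
    refine h x fun hx => ?_
    -- A pinned variable has one value in all solutions, so it cannot take both `0` and `1`.
    obtain ⟨β, hβ, e⟩ := ht (CT.num 0)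
    obtain ⟨β', hβ', e'⟩ := ht (CT.num 1)
    exact absurd (CT.num_inj (e.symm.trans ((hx.eq hβ hβ').trans e'))) zero_ne_one
  | num n => rfl
  | app f args =>
    obtain ⟨β, _, e⟩ := ht (CT.num 0)
    exact absurd e (CT.fn_ne_num _ _ _)

/-- The nontrivial clause concerns solutions of the original store that ignore `B`. Such a solution
is repaired on pinned variables to satisfy `B`. This leaves the identifiers alone, and the degrees
were already correct. -/
theorem GraphInvariantAt.encodesGraph {σ : CHRState S (graphSig TG) Var}
    (h : GraphInvariantAt CT σ) : EncodesGraph CT σ := by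
  obtain ⟨hσ, G, ν, B, hB, hequiv⟩ := h
  obtain ⟨g, hg, e⟩ := hequiv.symm.semEq.exists_family
    ⟨fun _ => CT.num 0, storeHolds_zero _ _⟩ (chrFamily G ν) (map_chrFamily G ν)
  simp only [sem_chrFamily] at e
  have hval : ∀ a b, ∃ α, StoreHolds CT.toInterp α (σ.store + B) ∧
      ∀ i, (g i).ground CT.toInterp α = graphVal G a (degVal CT G) b i := fun a b => by
    obtain ⟨α, _, hα, hM⟩ := (e (fun _ => CT.num 0) _).1 ⟨a, b, rfl⟩
    exact ⟨α, hα, hM⟩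
  refine ⟨G, g, hg, fun a b => ?_, ?_⟩
  · obtain ⟨α, hα, hM⟩ := hval a b
    exact ⟨α, α, fun _ _ => rfl, ((storeHolds_add _ _ _ _).1 hα).1, hM⟩
  · rintro M ⟨γ, α, _, hα, hM⟩ hdeg
    obtain ⟨α₀, hα₀, hM₀⟩ := hval (fun _ => CT.num 0) (fun _ => CT.num 0)
    obtain ⟨α', hα', hne⟩ := exists_solution_pinned hσ hB hα hα₀
    obtain ⟨a, b, hab⟩ := (e α' _).2 ⟨α', fun _ _ => rfl, hα', fun _ => rfl⟩
    refine ⟨a, b, funext fun i => ?_⟩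
    rw [← congrFun hab i, ← hM i]
    cases i with
    | inl v =>
      obtain ⟨s₁, s₂, hs⟩ := UserConstraint.exists_node_args (CT := CT)
        (congrArg Prod.fst (hM₀ (.inl v)))
      have h1 : s₁.eval CT.toInterp α' = s₁.eval CT.toInterp α := by
        refine Term.eval_eq_of_pinned (fun c => ?_) hne
        obtain ⟨β, hβ, hc⟩ := hval (fun _ => c) (fun _ => c)
        refine ⟨β, hβ, ?_⟩
        have := hc (.inl v)
        rw [hs] at this
        simp only [graphVal, Sum.elim_inl, Prod.mk.injEq, List.cons.injEq] at this
        exact this.2.1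
      -- A degree term may contain a pinned variable; both valuations give it the true degree, by
      -- hypothesis for `α` and by the encoding for `α'`.
      have h2 : s₂.eval CT.toInterp α = degVal CT G v := by
        obtain ⟨s, c, h⟩ := hdeg v
        rw [← hM, hs] at h
        simp only [Prod.mk.injEq, List.cons.injEq] at h
        exact h.2.2.1
      have h3 : s₂.eval CT.toInterp α' = degVal CT G v := by
        have := congrFun hab (.inl v)
        rw [hs] at this
        simp only [graphVal, Sum.elim_inl, Prod.mk.injEq, List.cons.injEq] at this
        exact this.2.2.1
      rw [hs, hs, h1, h2, h3]
    | inr d =>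
      obtain ⟨s₁, s₂, s₃, hs⟩ := UserConstraint.exists_edge_args (CT := CT)
        (congrArg Prod.fst (hM₀ (.inr d)))
      have key : ∀ c, ∃ β, StoreHolds CT.toInterp β (σ.store + B) ∧
          s₁.eval CT.toInterp β = c ∧ s₂.eval CT.toInterp β = c ∧ s₃.eval CT.toInterp β = c := by
        intro c
        obtain ⟨β, hβ, hc⟩ := hval (fun _ => c) (fun _ => c)
        have := hc (.inr d)
        rw [hs] at this
        simp only [graphVal, Sum.elim_inr, Prod.mk.injEq, List.cons.injEq] at this
        exact ⟨β, hβ, this.2.1, this.2.2.1, this.2.2.2.1⟩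
      rw [hs, hs, Term.eval_eq_of_pinned (fun c => (key c).imp fun β h => ⟨h.1, h.2.1⟩) hne,
        Term.eval_eq_of_pinned (fun c => (key c).imp fun β h => ⟨h.1, h.2.2.1⟩) hne,
        Term.eval_eq_of_pinned (fun c => (key c).imp fun β h => ⟨h.1, h.2.2.2⟩) hne]

/-- The equation that fixes the value of a term which is a variable. -/
def fixValue (n : ℤ) : Term S Var → Store S Var
  | .var x => {.eq (.var x) (.num n)}
  | _ => 0

/-- The added equations force each degree term to its true degree. Such a term attains a numeral, so
it is a variable, which is then fixed, or a numeral, which is already right. The attainable tuples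
become exactly the encodings of `G`, and completeness applies. -/
theorem EncodesGraph.graphInvariantAt [Infinite Var] {σ : CHRState S (graphSig TG) Var}
    (hσ : HasDegreeStore σ) (h : EncodesGraph CT σ) : GraphInvariantAt CT σ := by
  obtain ⟨G, g, hg, hG⟩ := h
  obtain ⟨ν⟩ := exists_naming (Var := Var) (G.V ⊕ G.E)
  have hval : ∀ a b, ∃ α, (StoreHolds CT.toInterp α σ.store) ∧
      ∀ i, (g i).ground CT.toInterp α = graphVal G a (degVal CT G) b i := fun a b => by
    obtain ⟨γ, α, _, hα, hM⟩ := hG.1 a b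
    exact ⟨α, hα, hM⟩
  obtain ⟨α₀, hα₀, hM₀⟩ := hval (fun _ => CT.num 0) (fun _ => CT.num 0)
  choose s₁ s₂ hs using fun v => UserConstraint.exists_node_args (CT := CT)
    (congrArg Prod.fst (hM₀ (.inl v)))
  have hdeg : ∀ {α : Var → CT.Carrier} {a b v},
      (g (.inl v)).ground CT.toInterp α = graphVal G a (degVal CT G) b (.inl v) →
      (s₂ v).eval CT.toInterp α = degVal CT G v := fun {α a b v} h => by
    rw [hs] at h
    simp only [graphVal, Sum.elim_inl, Prod.mk.injEq, List.cons.injEq] at h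
    exact h.2.2.1
  refine ⟨hσ, G, ν, Finset.univ.val.bind fun v => fixValue (G.deg v) (s₂ v), fun b hb => ?_, ?_⟩
  · obtain ⟨v, _, hb⟩ := Multiset.mem_bind.1 hb
    cases hv : s₂ v with
    | var x =>
      rw [hv, fixValue, Multiset.mem_singleton] at hb
      exact ⟨x, _, .inl ⟨_, rfl⟩, hb⟩
    | num n => rw [hv] at hb; exact absurd hb (Multiset.notMem_zero _)
    | app f args => rw [hv] at hb; exact absurd hb (Multiset.notMem_zero _)
  · rw [← hg, ← map_chrFamily]
    refine .of_sem fun γ M => ?_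
    rw [sem_chrFamily]
    constructor
    · rintro ⟨α, _, hα, hM⟩
      rw [storeHolds_add] at hα
      refine hG.2 M ⟨α, α, fun _ _ => rfl, hα.1, hM⟩ fun v => ?_
      suffices hv : (s₂ v).eval CT.toInterp α = degVal CT G v from
        ⟨_, _, by rw [← hM, hs, hv]⟩
      have h0 := hdeg (hM₀ (.inl v))
      cases hv : s₂ v with
      | var x =>
        refine hα.2 (.eq (.var x) (.num (G.deg v)))
          (Multiset.mem_bind.2 ⟨v, Finset.mem_univ v, ?_⟩)
        rw [hv, fixValue, Multiset.mem_singleton]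
      | num n => rw [hv] at h0; exact h0
      | app f args => rw [hv] at h0; exact absurd h0 (CT.fn_ne_num _ _ _)
    · rintro ⟨a, b, rfl⟩
      obtain ⟨α, hα, hM⟩ := hval a b
      refine ⟨α, by simp, (storeHolds_add _ _ _ _).2 ⟨hα, fun c hc => ?_⟩, hM⟩
      obtain ⟨v, _, hc⟩ := Multiset.mem_bind.1 hc
      have h0 := hdeg (hM (.inl v))
      cases hv : s₂ v with
      | var x =>
        rw [hv, fixValue, Multiset.mem_singleton] at hc
        subst hc
        rw [hv] at h0
        exact h0
      | num n => rw [hv] at hc; exact absurd hc (Multiset.notMem_zero _)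
      | app f args => rw [hv] at hc; exact absurd hc (Multiset.notMem_zero _)

end DegreeStores

/-! ### Graph rewriting on the level of values. -/

section Step

variable {S : BuiltinSig.{u}} {TG : FinGraph} {CT : ConstraintTheory.{u, w} S}

theorem graphVal_inj {C : Type w} {G : TypedGraph TG} {a a' d d' : G.V → C} {b b' : G.E → C}
    (h : graphVal G a d b = graphVal G a' d' b') : a = a' ∧ d = d' ∧ b = b' := by
  refine ⟨funext fun v => ?_, funext fun v => ?_, funext fun e => ?_⟩
  · have := congrFun h (.inl v)
    simp only [graphVal, Sum.elim_inl, Prod.mk.injEq, List.cons.injEq] at this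
    exact this.2.1
  · have := congrFun h (.inl v)
    simp only [graphVal, Sum.elim_inl, Prod.mk.injEq, List.cons.injEq] at this
    exact this.2.2.1
  · have := congrFun h (.inr e)
    simp only [graphVal, Sum.elim_inr, Prod.mk.injEq, List.cons.injEq] at this
    exact this.2.1

/-- A family on the elements of a graph, extended by further nodes and edges. -/
def glue {A B κ κ' X : Type*} (f : A ⊕ B → X) (m : κ → X) (m' : κ' → X) :
    (A ⊕ κ) ⊕ (B ⊕ κ') → X :=
  Sum.elim (Sum.elim (fun a => f (.inl a)) m) (Sum.elim (fun b => f (.inr b)) m')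

theorem glue_inj {A B κ κ' X : Type*} {f g : A ⊕ B → X} {m n : κ → X} {m' n' : κ' → X}
    (h : glue f m m' = glue g n n') : f = g ∧ m = n ∧ m' = n' := by
  refine ⟨funext fun i => ?_, funext fun i => congrFun h (.inl (.inr i)),
    funext fun i => congrFun h (.inr (.inr i))⟩
  cases i with
  | inl a => exact congrFun h (.inl (.inl a))
  | inr b => exact congrFun h (.inr (.inl b))

/-- The relation between the values on the left and on the right side of a production rule. -/
structure RuleVal (CT : ConstraintTheory.{u, w} S) (p : ProductionRule TG)
    (x d : p.L.V → CT.Carrier) (y : p.L.E → CT.Carrier) (x' d' : p.R.V → CT.Carrier)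
    (y' : p.R.E → CT.Carrier) : Prop where
  node : ∀ k, x' (p.r.onV k) = x (p.l.onV k)
  edge : ∀ k, y' (p.r.onE k) = y (p.l.onE k)
  deg : ∀ k, ∃ n : ℤ, d (p.l.onV k) = CT.num n ∧
    d' (p.r.onV k) = CT.num (n - p.L.deg (p.l.onV k) + p.R.deg (p.r.onV k))
  new : ∀ w, w ∉ Set.range p.r.onV → d' w = CT.num (p.R.deg w)

/-- The values after the application of a production rule, in terms of those before. -/
def StepRel (CT : ConstraintTheory.{u, w} S) (p : ProductionRule TG) {κ κ' : Type*}
    (Q : ((p.L.V ⊕ κ) ⊕ (p.L.E ⊕ κ') → (TG.V ⊕ TG.E) × List CT.Carrier) → Prop)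
    (M : (p.R.V ⊕ κ) ⊕ (p.R.E ⊕ κ') → (TG.V ⊕ TG.E) × List CT.Carrier) : Prop :=
  ∃ x d y x' d' y' m m', Q (glue (graphVal p.L x d y) m m') ∧
    M = glue (graphVal p.R x' d' y') m m' ∧ RuleVal CT p x d y x' d' y'

theorem FinGraph.deg_eq_sum (G : FinGraph) [DecidableEq G.V] (v : G.V) :
    G.deg v = ∑ e, (if G.src e = v then 1 else 0) + ∑ e, if G.tgt e = v then 1 else 0 := by
  rw [← Finset.card_filter, ← Finset.card_filter, FinGraph.deg]
  congr!

/-- The correspondence between the nodes before and after the application of a rule. -/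
def SameNode (p : ProductionRule TG) {κ : Type*} (z : p.L.V ⊕ κ) (z' : p.R.V ⊕ κ) : Prop :=
  (∃ k, z = .inl (p.l.onV k) ∧ z' = .inl (p.r.onV k)) ∨ ∃ j, z = .inr j ∧ z' = .inr j

theorem SameNode.elim_eq {p : ProductionRule TG} {κ X : Type*} {z : p.L.V ⊕ κ} {z' : p.R.V ⊕ κ}
    (h : SameNode p z z') {x : p.L.V → X} {x' : p.R.V → X} (m : κ → X)
    (hx : ∀ k, x' (p.r.onV k) = x (p.l.onV k)) : Sum.elim x' m z' = Sum.elim x m z := by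
  obtain ⟨k, rfl, rfl⟩ | ⟨j, rfl, rfl⟩ := h
  · exact hx k
  · rfl

theorem SameNode.eq_inl_iff {p : ProductionRule TG} {κ : Type*} {z : p.L.V ⊕ κ} {z' : p.R.V ⊕ κ}
    (h : SameNode p z z') (k : p.K.V) :
    z' = .inl (p.r.onV k) ↔ z = .inl (p.l.onV k) := by
  obtain ⟨k', rfl, rfl⟩ | ⟨j, rfl, rfl⟩ := h
  · simp [p.l.injV.eq_iff, p.r.injV.eq_iff]
  · simp

theorem SameNode.eq_inr_iff {p : ProductionRule TG} {κ : Type*} {z : p.L.V ⊕ κ} {z' : p.R.V ⊕ κ}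
    (h : SameNode p z z') (j : κ) : z' = .inr j ↔ z = .inr j := by
  obtain ⟨k', rfl, rfl⟩ | ⟨j, rfl, rfl⟩ := h <;> simp

theorem SameNode.ne_inl {p : ProductionRule TG} {κ : Type*} {z : p.L.V ⊕ κ} {z' : p.R.V ⊕ κ}
    (h : SameNode p z z') {w : p.R.V} (hw : w ∉ Set.range p.r.onV) : z' ≠ .inl w := by
  obtain ⟨k', rfl, rfl⟩ | ⟨j, rfl, rfl⟩ := h
  · intro e; exact hw ⟨k', Sum.inl_injective e⟩
  · simp

/-- Under the dangling condition, an endpoint of a context edge is preserved or lies in the context,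
so it survives. -/
theorem exists_sameNode {p : ProductionRule TG} {κ : Type*} (z : p.L.V ⊕ κ)
    (h : ∀ v, v ∉ Set.range p.l.onV → z ≠ .inl v) : ∃ z', SameNode p z z' := by
  cases z with
  | inl v =>
    by_cases hv : v ∈ Set.range p.l.onV
    · obtain ⟨k, rfl⟩ := hv
      exact ⟨_, .inl ⟨k, rfl, rfl⟩⟩
    · exact absurd rfl (h v hv)
  | inr j => exact ⟨_, .inr ⟨j, rfl, rfl⟩⟩

/-- A function on `L` whose values on the image of `K` are prescribed. -/
theorem exists_extend {A B : Type*} {C : Type w} {f : A → B} (hf : Function.Injective f) (c : C)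
    (g : A → C) : ∃ h : B → C, ∀ a, h (f a) = g a :=
  ⟨Function.extend f g fun _ => c, fun a => hf.extend_apply _ _ a⟩

/-- Distinct identifiers make it possible to read the endpoints of an edge off its values. -/
theorem ConstraintTheory.exists_injective (CT : ConstraintTheory.{u, w} S) (X : Type*)
    [Countable X] : ∃ f : X → CT.Carrier, Function.Injective f := by
  obtain ⟨f, hf⟩ := exists_injective_nat X
  exact ⟨fun x => CT.num (f x), fun a b h => hf (by exact_mod_cast CT.num_inj h)⟩

/-- The application of a production rule turns encodings of graphs into encodings of graphs. -/
theorem Encodes.step (p : ProductionRule TG) {κ κ' : Type} [Fintype κ] [Fintype κ']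
    {Q : ((p.L.V ⊕ κ) ⊕ (p.L.E ⊕ κ') → (TG.V ⊕ TG.E) × List CT.Carrier) → Prop}
    (hL : ∀ M, Q M → ∃ x d y m m', M = glue (graphVal p.L x d y) m m' ∧
      ∀ v, v ∉ Set.range p.l.onV → d v = CT.num (p.L.deg v))
    {G : TypedGraph TG} (iV : p.L.V ⊕ κ ≃ G.V) (iE : p.L.E ⊕ κ' ≃ G.E)
    (hG : Encodes CT G fun M => Q fun i => M (Sum.map iV iE i)) :
    ∃ (G' : TypedGraph TG) (φ : G'.V ⊕ G'.E ≃ (p.R.V ⊕ κ) ⊕ (p.R.E ⊕ κ')),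
      Encodes CT G' fun M => StepRel CT p Q fun i => M (φ.symm i) := by
  classical
  have hval : ∀ a b, ∃ x d y m m', (fun i => graphVal G a (degVal CT G) b (Sum.map iV iE i)) =
      glue (graphVal p.L x d y) m m' ∧
      ∀ v, v ∉ Set.range p.l.onV → d v = CT.num (p.L.deg v) := fun a b => hL _ (hG.1 a b)
  -- An encoding with distinct node identifiers shows that the head constraints occupy a copy of `L`
  -- inside `G`. The match is injective because distinct constraints index distinct elements.
  obtain ⟨a₀, ha₀⟩ := CT.exists_injective G.V
  obtain ⟨x₀, d₀, y₀, m₀, m₀', h₀, hd₀⟩ := hval a₀ fun _ => CT.num 0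
  have hnode : ∀ v, G.type.onV (iV (.inl v)) = p.L.type.onV v ∧ a₀ (iV (.inl v)) = x₀ v ∧
      degVal CT G (iV (.inl v)) = d₀ v := fun v => by
    simpa [glue, graphVal] using congrFun h₀ (.inl (.inl v))
  have hedge : ∀ e, G.type.onE (iE (.inl e)) = p.L.type.onE e ∧
      G.src (iE (.inl e)) = iV (.inl (p.L.src e)) ∧
      G.tgt (iE (.inl e)) = iV (.inl (p.L.tgt e)) := fun e => by
    have := congrFun h₀ (.inr (.inl e))
    simp only [glue, graphVal, Sum.map_inr, Sum.elim_inr, Sum.elim_inl, Prod.mk.injEq,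
      Sum.inr.injEq, List.cons.injEq, and_true] at this
    exact ⟨this.1, ha₀ (this.2.2.1.trans (hnode _).2.1.symm),
      ha₀ (this.2.2.2.trans (hnode _).2.1.symm)⟩
  let s : κ' → p.L.V ⊕ κ := fun k => iV.symm (G.src (iE (.inr k)))
  let t : κ' → p.L.V ⊕ κ := fun k => iV.symm (G.tgt (iE (.inr k)))
  have hs : ∀ k, G.src (iE (.inr k)) = iV (s k) := fun k => by simp [s]
  have ht : ∀ k, G.tgt (iE (.inr k)) = iV (t k) := fun k => by simp [t]
  -- The contribution of the context edges to the degree of `z`.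
  let N : p.L.V ⊕ κ → ℕ := fun z =>
    ∑ k, (if s k = z then 1 else 0) + ∑ k, if t k = z then 1 else 0
  have hdegL : ∀ v, G.deg (iV (.inl v)) = p.L.deg v + N (.inl v) := fun v => by
    rw [FinGraph.deg_eq_sum, FinGraph.deg_eq_sum, ← Equiv.sum_comp iE, ← Equiv.sum_comp iE]
    simp only [Fintype.sum_sum_type, (hedge _).2.1, (hedge _).2.2, hs, ht, iV.injective.eq_iff,
      Sum.inl_injective.eq_iff, N]
    ring
  have hdegκ : ∀ j, G.deg (iV (.inr j)) = N (.inr j) := fun j => by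
    rw [FinGraph.deg_eq_sum, ← Equiv.sum_comp iE, ← Equiv.sum_comp iE]
    simp only [Fintype.sum_sum_type, (hedge _).2.1, (hedge _).2.2, hs, ht, iV.injective.eq_iff,
      reduceCtorEq, if_false, Finset.sum_const_zero, zero_add, N]
  -- A deleted node is labelled with its degree in `L`, and this label is its degree in `G`. Nothing
  -- is left for context edges.
  have hdangling : ∀ v, v ∉ Set.range p.l.onV → N (.inl v) = 0 := fun v hv => by
    have h1 : (p.L.deg v : ℤ) = G.deg (iV (.inl v)) :=
      CT.num_inj ((hd₀ v hv).symm.trans (hnode v).2.2.symm)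
    have := hdegL v
    omega
  have hdangling' : ∀ v, v ∉ Set.range p.l.onV → ∀ k, s k ≠ .inl v ∧ t k ≠ .inl v := by
    intro v hv k
    have := hdangling v hv
    simp only [N, Nat.add_eq_zero_iff, Finset.sum_eq_zero_iff, Finset.mem_univ, true_imp_iff,
      ite_eq_right_iff, one_ne_zero, imp_false] at this
    exact ⟨this.1 k, this.2 k⟩
  choose s' hs' using fun k => exists_sameNode (s k) fun v hv => (hdangling' v hv k).1
  choose t' ht' using fun k => exists_sameNode (t k) fun v hv => (hdangling' v hv k).2
  let ty : κ → TG.V := fun j => G.type.onV (iV (.inr j))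
  have hty : ∀ z, G.type.onV (iV z) = Sum.elim p.L.type.onV ty z := by
    rintro (v | j)
    · exact (hnode v).1
    · rfl
  have htyK : ∀ k, p.R.type.onV (p.r.onV k) = p.L.type.onV (p.l.onV k) := fun k => by
    rw [p.r.typeV, p.l.typeV]
  -- The result of rewriting: `R` glued to the context, with context edges redirected along
  -- `SameNode`.
  let G' : TypedGraph TG :=
    { V := p.R.V ⊕ κ
      E := p.R.E ⊕ κ'
      src := Sum.elim (fun e => .inl (p.R.src e)) s'
      tgt := Sum.elim (fun e => .inl (p.R.tgt e)) t'
      type :=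
        { onV := Sum.elim p.R.type.onV ty
          onE := Sum.elim p.R.type.onE fun k => G.type.onE (iE (.inr k))
          src_comm := by
            rintro (e | k)
            · exact p.R.type.src_comm e
            · simp only [Sum.elim_inr]
              rw [(hs' k).elim_eq ty htyK, ← hty, ← hs, G.type.src_comm]
          tgt_comm := by
            rintro (e | k)
            · exact p.R.type.tgt_comm e
            · simp only [Sum.elim_inr]
              rw [(ht' k).elim_eq ty htyK, ← hty, ← ht, G.type.tgt_comm] } }
  have hdeg' : ∀ z : p.R.V ⊕ κ, G'.deg z =
      (∑ e, (if (Sum.inl (p.R.src e) : p.R.V ⊕ κ) = z then 1 else 0) +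
        ∑ k, if s' k = z then 1 else 0) +
      (∑ e, (if (Sum.inl (p.R.tgt e) : p.R.V ⊕ κ) = z then 1 else 0) +
        ∑ k, if t' k = z then 1 else 0) := fun z => by
    rw [FinGraph.deg_eq_sum]
    erw [Fintype.sum_sum_type, Fintype.sum_sum_type]
    rfl
  have hdegK : ∀ k, G'.deg (Sum.inl (p.r.onV k)) =
      p.R.deg (p.r.onV k) + N (.inl (p.l.onV k)) := fun k => by
    rw [hdeg', FinGraph.deg_eq_sum]
    simp only [(hs' _).eq_inl_iff, (ht' _).eq_inl_iff, Sum.inl_injective.eq_iff, N]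
    ring
  have hdegR : ∀ w, w ∉ Set.range p.r.onV → G'.deg (Sum.inl w) = p.R.deg w := fun w hw => by
    rw [hdeg', FinGraph.deg_eq_sum]
    simp [(hs' _).ne_inl hw, (ht' _).ne_inl hw, Sum.inl_injective.eq_iff]
  have hdegκ' : ∀ j, G'.deg (Sum.inr j) = G.deg (iV (.inr j)) := fun j => by
    rw [hdeg', hdegκ]
    simp [(hs' _).eq_inr_iff, (ht' _).eq_inr_iff, N]
  refine ⟨G', Equiv.refl _, fun a' b' => ?_, ?_⟩
  -- Identifiers for `G` are those of `G'` on the preserved elements and the context; deleted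
  -- elements may get any value, here `0`.
  · obtain ⟨xL, hxL⟩ := exists_extend p.l.injV (CT.num 0) fun k => a' (Sum.inl (p.r.onV k))
    obtain ⟨yL, hyL⟩ := exists_extend p.l.injE (CT.num 0) fun k => b' (Sum.inl (p.r.onE k))
    let a : G.V → CT.Carrier := fun v => Sum.elim xL (fun j => a' (Sum.inr j)) (iV.symm v)
    let b : G.E → CT.Carrier := fun e => Sum.elim yL (fun j => b' (Sum.inr j)) (iE.symm e)
    have ha : ∀ z, a (iV z) = Sum.elim xL (fun j => a' (Sum.inr j)) z := fun z => by simp [a]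
    have hb : ∀ z, b (iE z) = Sum.elim yL (fun j => b' (Sum.inr j)) z := fun z => by simp [b]
    have ha' : ∀ z, a' z = Sum.elim (fun w => a' (Sum.inl w)) (fun j => a' (Sum.inr j)) z := by
      rintro (w | j) <;> rfl
    refine ⟨xL, fun v => degVal CT G (iV (.inl v)), yL, fun w => a' (Sum.inl w),
      fun w => degVal CT G' (Sum.inl w), fun e => b' (Sum.inl e),
      fun j => graphVal G a (degVal CT G) b (.inl (iV (.inr j))),
      fun k => graphVal G a (degVal CT G) b (.inr (iE (.inr k))), ?_, ?_, ?_⟩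
    · have := hG.1 a b
      convert this using 1
      funext i
      rcases i with (v | j) | (e | k)
      · simp [glue, graphVal, ha, (hnode v).1]
      · rfl
      · simp [glue, graphVal, ha, hb, hedge]
      · rfl
    · funext i
      rcases i with (w | j) | (e | k)
      · rfl
      · simp only [glue, Sum.elim_inl, Sum.elim_inr, graphVal, ha, degVal, ← hdegκ']
        rfl
      · rfl
      · simp only [glue, Sum.elim_inl, Sum.elim_inr, graphVal, ha, hb, hs, ht, ← (hs' k).elim_eq
          (x' := fun w => a' (Sum.inl w)) (fun j => a' (Sum.inr j)) fun k => (hxL k).symm,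
          ← (ht' k).elim_eq
          (x' := fun w => a' (Sum.inl w)) (fun j => a' (Sum.inr j)) fun k => (hxL k).symm]
        rw [← ha', ← ha']
        rfl
    · refine ⟨fun k => (hxL k).symm, fun k => (hyL k).symm, fun k => ⟨_, rfl, ?_⟩, fun w hw => ?_⟩
      · simp only [degVal, hdegK, hdegL]
        congr 1
        push_cast
        ring
      · simp only [degVal, hdegR w hw]
  · rintro M' ⟨x, d, y, x', d', y', m, m', hQ, hM', hR⟩ hdegM
    have hMV : ∀ w, M' (.inl (Sum.inl w)) = (.inl (p.R.type.onV w), [x' w, d' w]) := fun w =>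
      congrFun hM' (.inl (.inl w))
    have hMκ : ∀ j, M' (.inl (Sum.inr j)) = m j := fun j => congrFun hM' (.inl (.inr j))
    have hME : ∀ e, M' (.inr (Sum.inl e)) =
        (.inr (p.R.type.onE e), [y' e, x' (p.R.src e), x' (p.R.tgt e)]) := fun e =>
      congrFun hM' (.inr (.inl e))
    have hMκ' : ∀ k, M' (.inr (Sum.inr k)) = m' k := fun k => congrFun hM' (.inr (.inr k))
    have hd' : ∀ w, d' w = degVal CT G' (Sum.inl w) := fun w => by
      obtain ⟨_, c, h⟩ := hdegM (Sum.inl w)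
      rw [hMV] at h
      simp only [Prod.mk.injEq, List.cons.injEq] at h
      exact h.2.2.1
    -- The degrees before the step are recovered: for preserved nodes by inverting the update, for
    -- deleted ones from the label and the dangling condition.
    have hd : ∀ v, d v = degVal CT G (iV (.inl v)) := fun v => by
      by_cases hv : v ∈ Set.range p.l.onV
      · obtain ⟨k, rfl⟩ := hv
        obtain ⟨n, hn, hn'⟩ := hR.deg k
        rw [hd'] at hn'
        have := CT.num_inj hn'
        rw [hdegK] at this
        rw [hn, degVal, hdegL]
        congr 1
        push_cast at this ⊢
        omega
      · obtain ⟨_, d₁, _, _, _, h, hd₁⟩ := hL _ hQ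
        obtain ⟨rfl, -⟩ := (graphVal_inj (glue_inj h).1).2
        rw [hd₁ v hv, degVal, hdegL, hdangling v hv, add_zero]
    have hQ' : Q fun i => glue (graphVal p.L x d y) m m' (Sum.map iV.symm iE.symm
        (Sum.map iV iE i)) := by simpa using hQ
    obtain ⟨a, b, hab⟩ := hG.2 (fun i => glue (graphVal p.L x d y) m m'
      (Sum.map iV.symm iE.symm i)) hQ' fun v => by
        obtain ⟨z, rfl⟩ := iV.surjective v
        rcases z with v | j
        · exact ⟨_, _, by simp [glue, graphVal, hd]; exact ⟨rfl, rfl⟩⟩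
        · obtain ⟨s, c, h⟩ := hdegM (Sum.inr j)
          rw [hMκ] at h
          exact ⟨s, c, by simp [glue, h, degVal, hdegκ']⟩
    have hab' : ∀ i, glue (graphVal p.L x d y) m m' i =
        graphVal G a (degVal CT G) b (Sum.map iV iE i) := fun i => by
      simpa using congrFun hab (Sum.map iV iE i)
    have hx : ∀ v, x v = a (iV (.inl v)) := fun v => by
      have := hab' (.inl (.inl v))
      simp [glue, graphVal] at this
      exact this.2.1
    have ha : ∀ z, a (iV z) = Sum.elim x (fun j => a (iV (.inr j))) z := by
      rintro (v | j)
      · exact (hx v).symm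
      · rfl
    -- The old values encode `G`, so the context keeps its identifiers, and `R` contributes the new
    -- ones.
    refine ⟨Sum.elim x' fun j => a (iV (.inr j)), Sum.elim y' fun k => b (iE (.inr k)), ?_⟩
    funext i
    rcases i with (w | j) | (e | k)
    · rw [hMV, hd']
      rfl
    · rw [hMκ]
      refine (hab' (.inl (.inr j))).trans ?_
      simp only [graphVal, Sum.map_inl, Sum.elim_inl, degVal, ← hdegκ']
      rfl
    · rw [hME]
      rfl
    · rw [hMκ']
      refine (hab' (.inr (.inr k))).trans ?_
      simp only [graphVal, Sum.map_inr, Sum.elim_inr, hs, ht]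
      rw [ha (s k), ha (t k), ← (hs' k).elim_eq _ hR.node, ← (ht' k).elim_eq _ hR.node]
      rfl

end Step

/-! ### Freshness of the variables of a rule copy. -/

section FreshCopies

variable {S : BuiltinSig.{u}} {U : UserSig} {Var : Type v}

/-- A valuation can be changed at will on the fresh variables of a copy of a rule. -/
theorem CHRRule.exists_fresh_extension {C : Type w} {r : CHRRule S U Var} {ρ : Var → Var}
    (hρ : Set.InjOn ρ r.vars) {G : Goal S U Var} {B : Store S Var} {V : Finset Var}
    (hV : ∀ x ∈ (r.rename ρ).vars, x ∉ V)
    (hfresh : ∀ x ∈ (r.rename ρ).vars, x ∉ (r.rename ρ).headVars →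
      x ∉ goalVars G ∧ x ∉ storeVars B) (α f : Var → C) :
    ∃ α' : Var → C, (∀ y ∈ r.headVars, α' (ρ y) = α (ρ y)) ∧
      (∀ y ∈ r.vars, y ∉ r.headVars → α' (ρ y) = f y) ∧ (∀ x ∈ V, α' x = α x) ∧
      (∀ x ∈ goalVars G, α' x = α x) ∧ ∀ x ∈ storeVars B, α' x = α x := by
  classical
  rw [CHRRule.vars_rename] at hV hfresh
  rw [CHRRule.headVars_rename] at hfresh
  have hsub : r.headVars ⊆ r.vars := fun x hx => .inl (.inl (.inl hx))
  have hold : ∀ x, (∀ y ∈ r.vars, y ∉ r.headVars → ρ y ≠ x) →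
      (if h : ∃ y ∈ r.vars, y ∉ r.headVars ∧ ρ y = x then f h.choose else α x) = α x := by
    intro x hx
    rw [dif_neg]
    rintro ⟨y, h1, h2, h3⟩
    exact hx y h1 h2 h3
  -- Injectivity of `ρ` keeps body-only variables apart from the head of the copy, so the freshness
  -- condition applies to them.
  have hnot : ∀ y ∈ r.vars, y ∉ r.headVars → ρ y ∉ goalVars G ∧ ρ y ∉ storeVars B :=
    fun y h1 h2 => hfresh _ ⟨y, h1, rfl⟩ fun ⟨z, hz, e⟩ => h2 (hρ (hsub hz) h1 e ▸ hz)
  refine ⟨fun x => if h : ∃ y ∈ r.vars, y ∉ r.headVars ∧ ρ y = x then f h.choose else α x,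
    fun y hy => hold _ fun z hz hz' e => hz' (hρ hz (hsub hy) e ▸ hy), fun y hy hy' => ?_,
    fun x hx => hold _ fun z hz _ e => hV _ ⟨z, hz, rfl⟩ (e ▸ hx),
    fun x hx => hold _ fun z hz hz' e => (hnot z hz hz').1 (e ▸ hx),
    fun x hx => hold _ fun z hz hz' e => (hnot z hz hz').2 (e ▸ hx)⟩
  have h : ∃ z ∈ r.vars, z ∉ r.headVars ∧ ρ z = ρ y := ⟨y, hy, hy', rfl⟩
  simp only [dif_pos h]
  congr 1
  exact hρ h.choose_spec.1 hy h.choose_spec.2.2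

end FreshCopies

/-! ### Values of the encoded production rules. -/

section RuleSemantics

variable {S : BuiltinSig.{u}} {Var : Type v} {TG : FinGraph} {CT : ConstraintTheory.{u, w} S}
  (p : ProductionRule TG) (ν : Naming (RuleItem p) Var)

/-- The encoding lists elements of `K` and the remaining ones separately; this recombines them into
a family on all of `L` or `R`. -/
theorem map_univ_split {A B X : Type*} [Fintype A] [Fintype B] {f : A → B}
    (hf : Function.Injective f) (h : B → X) [DecidablePred (· ∉ Set.range f)] :
    Finset.univ.val.map h = Finset.univ.val.map (fun a => h (f a)) +
      (Finset.univ.filter (· ∉ Set.range f)).val.map h := by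
  classical
  have h1 : Finset.univ.val.map (fun a => h (f a)) =
      (Finset.univ.filter (· ∈ Set.range f)).val.map h := by
    have : (Finset.univ.filter (· ∈ Set.range f)) = Finset.univ.map ⟨f, hf⟩ := by
      ext; simp
    rw [this, Finset.map_val, Multiset.map_map]
    rfl
  rw [h1, ← Multiset.map_add, Finset.filter_val, Finset.filter_val]
  convert (congrArg (Multiset.map h) (Multiset.filter_add_not (· ∈ Set.range f)
    (Finset.univ : Finset B).val)).symm

open Classical in
/-- The constraints of the head of an encoded production rule, indexed by the elements of `L`. -/
noncomputable def leftFamily : p.L.V ⊕ p.L.E → UserConstraint S (graphSig TG) Var :=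
  Sum.elim (fun v => if v ∈ Set.range p.l.onV then p.leftNodeKp ν v else p.leftNodeGnd ν v)
    (p.leftEdge ν)

open Classical in
/-- The constraints of the body of an encoded production rule, indexed by the elements of `R`. -/
noncomputable def rightFamily : p.R.V ⊕ p.R.E → UserConstraint S (graphSig TG) Var :=
  Sum.elim (fun w => if h : w ∈ Set.range p.r.onV then p.copyNodeKp ν h.choose
    else p.rightNodeGnd ν w) (p.rightEdge ν)

theorem choose_range_apply {A B : Type*} {f : A → B} (hf : Function.Injective f) (a : A)
    (h : f a ∈ Set.range f) : h.choose = a :=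
  hf h.choose_spec

theorem map_leftFamily :
    Finset.univ.val.map (leftFamily (S := S) p ν) = (p.encode ν).removed := by
  classical
  rw [leftFamily, map_univ_sumElim, map_univ_split p.l.injV, map_univ_split p.l.injE]
  simp only [ProductionRule.encode]
  have h1 : Multiset.map (fun v => if v ∈ Set.range p.l.onV then p.leftNodeKp (S := S) ν v
      else p.leftNodeGnd ν v) (Finset.univ.filter (· ∉ Set.range p.l.onV)).val =
      (Finset.univ.filter (· ∉ Set.range p.l.onV)).val.map (p.leftNodeGnd ν) :=
    Multiset.map_congr rfl fun v hv => if_neg (Finset.mem_filter.1 hv).2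
  rw [h1]
  simp only [Set.mem_range_self, if_true]
  abel_nf

theorem map_rightFamily :
    Finset.univ.val.map (rightFamily (S := S) p ν) = (p.encode ν).bodyU := by
  classical
  rw [rightFamily, map_univ_sumElim, map_univ_split p.r.injV, map_univ_split p.r.injE]
  simp only [ProductionRule.encode]
  have h1 : Multiset.map (fun v => if h : v ∈ Set.range p.r.onV then
      p.copyNodeKp (S := S) ν h.choose
      else p.rightNodeGnd ν v) (Finset.univ.filter (· ∉ Set.range p.r.onV)).val =
      (Finset.univ.filter (· ∉ Set.range p.r.onV)).val.map (p.rightNodeGnd ν) :=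
    Multiset.map_congr rfl fun v hv => dif_neg (Finset.mem_filter.1 hv).2
  rw [h1]
  simp only [Set.mem_range_self, dif_pos, choose_range_apply p.r.injV]
  abel_nf

variable {p}

theorem rightV_onV (k : p.K.V) : p.rightV (p.r.onV k) = .leftV (p.l.onV k) := by
  rw [ProductionRule.rightV, dif_pos ⟨k, rfl⟩]
  exact congrArg (fun k => RuleItem.leftV (p.l.onV k)) (choose_range_apply p.r.injV k _)

theorem rightE_onE (k : p.K.E) : p.rightE (p.r.onE k) = .leftE (p.l.onE k) := by
  rw [ProductionRule.rightE, dif_pos ⟨k, rfl⟩]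
  exact congrArg (fun k => RuleItem.leftE (p.l.onE k)) (choose_range_apply p.r.injE k _)

theorem rightV_of_notMem {w : p.R.V} (hw : w ∉ Set.range p.r.onV) :
    p.rightV w = .newV ⟨w, hw⟩ := by
  rw [ProductionRule.rightV, dif_neg hw]

theorem rightE_of_notMem {e : p.R.E} (he : e ∉ Set.range p.r.onE) :
    p.rightE e = .newE ⟨e, he⟩ := by
  rw [ProductionRule.rightE, dif_neg he]

open Classical in
/-- The degree labels of the head under a valuation. -/
noncomputable def leftDeg (CT : ConstraintTheory.{u, w} S) (ν : Naming (RuleItem p) Var)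
    (β : Var → CT.Carrier) (v : p.L.V) : CT.Carrier :=
  if v ∈ Set.range p.l.onV then β (ν.dvar (.leftV v)) else CT.num (p.L.deg v)

open Classical in
/-- The degree labels of the body under a valuation. -/
noncomputable def rightDeg (CT : ConstraintTheory.{u, w} S) (ν : Naming (RuleItem p) Var)
    (β : Var → CT.Carrier) (w : p.R.V) : CT.Carrier :=
  if h : w ∈ Set.range p.r.onV then β (ν.dvar (.copyV h.choose)) else CT.num (p.R.deg w)

theorem ground_leftFamily (β : Var → CT.Carrier) :
    (fun i => (leftFamily p ν i).ground CT.toInterp β) =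
      graphVal p.L (fun v => β (ν.var (.leftV v))) (leftDeg CT ν β)
        (fun e => β (ν.var (.leftE e))) := by
  funext i
  rcases i with v | e
  · by_cases hv : v ∈ Set.range p.l.onV
    · simp only [leftFamily, Sum.elim_inl, graphVal, leftDeg, if_pos hv]
      rfl
    · simp only [leftFamily, Sum.elim_inl, graphVal, leftDeg, if_neg hv]
      rfl
  · rfl

/-- In the body, a preserved node appears through its copy, whereas edges still refer to the
original. The equations of the hypothesis identify the two, so the values form a graph. -/
theorem ground_rightFamily {β : Var → CT.Carrier}
    (hβ : ∀ k, β (ν.var (.leftV (p.l.onV k))) = β (ν.var (.copyV k))) :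
    (fun i => (rightFamily p ν i).ground CT.toInterp β) =
      graphVal p.R (fun w => β (ν.var (p.rightV w))) (rightDeg CT ν β)
        (fun e => β (ν.var (p.rightE e))) := by
  funext i
  rcases i with w | e
  · by_cases hw : w ∈ Set.range p.r.onV
    · obtain ⟨k, rfl⟩ := hw
      simp only [rightFamily, Sum.elim_inl, graphVal, rightDeg, Set.mem_range_self, dif_pos,
        choose_range_apply p.r.injV, ProductionRule.copyNodeKp, ground_nodeConstraint, rightV_onV,
        hβ]
      rfl
    · simp only [rightFamily, Sum.elim_inl, graphVal, rightDeg, dif_neg hw]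
      rfl
  · rfl

theorem storeHolds_bodyB {β : Var → CT.Carrier} :
    StoreHolds CT.toInterp β (p.encode ν).bodyB ↔
      ∀ k, β (ν.var (.leftV (p.l.onV k))) = β (ν.var (.copyV k)) ∧
        ∃ n : ℤ, β (ν.dvar (.leftV (p.l.onV k))) = CT.num n ∧
          β (ν.dvar (.copyV k)) =
            CT.num (n - p.L.deg (p.l.onV k) + p.R.deg (p.r.onV k)) := by
  refine (storeHolds_add _ _ _ _).trans ?_
  simp only [StoreHolds, Multiset.forall_mem_map_iff, Finset.mem_val, Finset.mem_univ,
    forall_true_left, forall_and]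
  refine and_congr Iff.rfl (forall_congr' fun k => ?_)
  simp only [Builtin.Holds, ArithExp.Evaluates]
  constructor
  · rintro ⟨_, h, i, j, ⟨n, l, hn, rfl, rfl⟩, rfl, rfl⟩
    exact ⟨n, hn, h⟩
  · rintro ⟨n, hn, h⟩
    exact ⟨_, h, _, _, ⟨_, _, hn, rfl, rfl⟩, rfl, rfl⟩

theorem headVars_encode :
    (p.encode (S := S) ν).headVars = goalVars (Finset.univ.val.map (leftFamily (S := S) p ν)) := by
  rw [map_leftFamily]
  simp [CHRRule.headVars, ProductionRule.encode, goalVars]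

theorem mem_vars_nodeConstraint {t : TG.V} {x y : Var} {d : Term S Var} :
    y ∈ (nodeConstraint t x d).vars ↔ y = x ∨ y ∈ d.vars := by
  simp only [UserConstraint.vars, nodeConstraint, Set.mem_iUnion]
  exact Fin.exists_fin_two

theorem mem_vars_edgeConstraint {t : TG.E} {x y z a : Var} :
    a ∈ (edgeConstraint (S := S) t x y z).vars ↔ a = x ∨ a = y ∨ a = z := by
  simp only [UserConstraint.vars, edgeConstraint, Set.mem_iUnion]
  refine (Fin.exists_fin_succ (n := 2)).trans (or_congr Iff.rfl ?_)
  exact Fin.exists_fin_two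

/-- With the injectivity of the naming, this shows that the variables of new elements and of copies
are body-only and hence free to be set. -/
theorem mem_headVars_encode {x : Var} (hx : x ∈ (p.encode (S := S) ν).headVars) :
    (∃ v, x = ν.var (.leftV v)) ∨ (∃ e, x = ν.var (.leftE e)) ∨ ∃ v, x = ν.dvar (.leftV v) := by
  rw [headVars_encode] at hx
  obtain ⟨v | e, hi⟩ := mem_goalVars.1 hx
  · simp only [leftFamily, Sum.elim_inl] at hi
    split_ifs at hi
    · obtain h | h := mem_vars_nodeConstraint.1 hi
      · exact .inl ⟨v, h⟩
      · exact .inr (.inr ⟨v, h⟩)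
    · obtain h | h := mem_vars_nodeConstraint.1 hi
      · exact .inl ⟨v, h⟩
      · exact absurd h (Set.notMem_empty _)
  · obtain h | h | h := mem_vars_edgeConstraint.1 hi
    · exact .inr (.inl ⟨_, h⟩)
    · exact .inl ⟨_, h⟩
    · exact .inl ⟨_, h⟩

theorem leftV_mem_headVars (v : p.L.V) : ν.var (.leftV v) ∈ (p.encode (S := S) ν).headVars := by
  rw [headVars_encode, mem_goalVars]
  refine ⟨.inl v, ?_⟩
  simp only [leftFamily, Sum.elim_inl]
  split_ifs <;> exact mem_vars_nodeConstraint.2 (.inl rfl)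

theorem leftE_mem_headVars (e : p.L.E) : ν.var (.leftE e) ∈ (p.encode (S := S) ν).headVars := by
  rw [headVars_encode, mem_goalVars]
  exact ⟨.inr e, mem_vars_edgeConstraint.2 (.inl rfl)⟩

theorem dvar_mem_headVars (k : p.K.V) :
    ν.dvar (.leftV (p.l.onV k)) ∈ (p.encode (S := S) ν).headVars := by
  rw [headVars_encode, mem_goalVars]
  refine ⟨.inl (p.l.onV k), ?_⟩
  simp only [leftFamily, Sum.elim_inl, Set.mem_range_self, if_true]
  exact mem_vars_nodeConstraint.2 (.inr rfl)

theorem mem_vars_encode_of_mem_right {x : Var} {i : p.R.V ⊕ p.R.E}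
    (h : x ∈ (rightFamily (S := S) p ν i).vars) : x ∈ (p.encode (S := S) ν).vars := by
  refine .inl (.inr ?_)
  rw [← map_rightFamily, mem_goalVars]
  exact ⟨i, h⟩

theorem newV_fresh {w : p.R.V} (hw : w ∉ Set.range p.r.onV) :
    ν.var (.newV ⟨w, hw⟩) ∈ (p.encode (S := S) ν).vars ∧
      ν.var (.newV ⟨w, hw⟩) ∉ (p.encode (S := S) ν).headVars := by
  constructor
  · refine mem_vars_encode_of_mem_right ν (i := .inl w) ?_
    simp only [rightFamily, Sum.elim_inl, dif_neg hw, ProductionRule.rightNodeGnd,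
      rightV_of_notMem hw]
    exact mem_vars_nodeConstraint.2 (.inl rfl)
  · intro h
    obtain ⟨v, h⟩ | ⟨v, h⟩ | ⟨v, h⟩ := mem_headVars_encode ν h
    · simpa using ν.var_inj h
    · simpa using ν.var_inj h
    · exact ν.var_ne_dvar _ _ h

theorem newE_fresh {e : p.R.E} (he : e ∉ Set.range p.r.onE) :
    ν.var (.newE ⟨e, he⟩) ∈ (p.encode (S := S) ν).vars ∧
      ν.var (.newE ⟨e, he⟩) ∉ (p.encode (S := S) ν).headVars := by
  constructor
  · refine mem_vars_encode_of_mem_right ν (i := .inr e) ?_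
    simp only [rightFamily, Sum.elim_inr, ProductionRule.rightEdge, rightE_of_notMem he]
    exact mem_vars_edgeConstraint.2 (.inl rfl)
  · intro h
    obtain ⟨v, h⟩ | ⟨v, h⟩ | ⟨v, h⟩ := mem_headVars_encode ν h
    · simpa using ν.var_inj h
    · simpa using ν.var_inj h
    · exact ν.var_ne_dvar _ _ h

theorem copyV_fresh (k : p.K.V) :
    ν.var (.copyV k) ∈ (p.encode (S := S) ν).vars ∧
      ν.var (.copyV k) ∉ (p.encode (S := S) ν).headVars := by
  constructor
  · refine mem_vars_encode_of_mem_right ν (i := .inl (p.r.onV k)) ?_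
    simp only [rightFamily, Sum.elim_inl, Set.mem_range_self, dif_pos,
      choose_range_apply p.r.injV]
    exact mem_vars_nodeConstraint.2 (.inl rfl)
  · intro h
    obtain ⟨v, h⟩ | ⟨v, h⟩ | ⟨v, h⟩ := mem_headVars_encode ν h
    · simpa using ν.var_inj h
    · simpa using ν.var_inj h
    · exact ν.var_ne_dvar _ _ h

theorem copyV_dvar_fresh (k : p.K.V) :
    ν.dvar (.copyV k) ∈ (p.encode (S := S) ν).vars ∧
      ν.dvar (.copyV k) ∉ (p.encode (S := S) ν).headVars := by
  constructor
  · refine mem_vars_encode_of_mem_right ν (i := .inl (p.r.onV k)) ?_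
    simp only [rightFamily, Sum.elim_inl, Set.mem_range_self, dif_pos,
      choose_range_apply p.r.injV]
    exact mem_vars_nodeConstraint.2 (.inr rfl)
  · intro h
    obtain ⟨v, h⟩ | ⟨v, h⟩ | ⟨v, h⟩ := mem_headVars_encode ν h
    · exact ν.var_ne_dvar _ _ h.symm
    · exact ν.var_ne_dvar _ _ h.symm
    · simpa using ν.dvar_inj h

/-- A valuation with prescribed values of `var` and `dvar`. -/
theorem Naming.exists_valuation {X : Type} (ν : Naming X Var) {C : Type w} (c : C) (F D : X → C) :
    ∃ f : Var → C, (∀ x, f (ν.var x) = F x) ∧ ∀ x, f (ν.dvar x) = D x := by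
  have hinj : Function.Injective (Sum.elim ν.var ν.dvar) :=
    ν.var_inj.sumElim ν.dvar_inj ν.var_ne_dvar
  exact ⟨Function.extend (Sum.elim ν.var ν.dvar) (Sum.elim F D) fun _ => c,
    fun x => hinj.extend_apply _ _ (.inl x), fun x => hinj.extend_apply _ _ (.inr x)⟩

/-- The copy of a family of constraints under a renaming of variables. -/
def renameFamily {U : UserSig} {ι : Type*} (ρ : Var → Var) (g : ι → UserConstraint S U Var)
    (i : ι) : UserConstraint S U Var :=
  (g i).subst fun x => .var (ρ x)

theorem map_renameFamily {U : UserSig} {ι : Type*} [Fintype ι] (ρ : Var → Var)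
    (g : ι → UserConstraint S U Var) :
    Finset.univ.val.map (renameFamily ρ g) = goalRename ρ (Finset.univ.val.map g) := by
  simp only [goalRename, Multiset.map_map, Function.comp_def]
  rfl

theorem glue_ground {A B κ κ' : Type*} {f : A ⊕ B → UserConstraint S (graphSig TG) Var}
    {m : κ → UserConstraint S (graphSig TG) Var} {m' : κ' → UserConstraint S (graphSig TG) Var}
    (α : Var → CT.Carrier) :
    (fun i => (glue f m m' i).ground CT.toInterp α) =
      glue (fun i => (f i).ground CT.toInterp α) (fun j => (m j).ground CT.toInterp α)
        (fun j => (m' j).ground CT.toInterp α) := by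
  funext i
  rcases i with (a | j) | (b | j) <;> rfl

theorem ground_renameFamily {ι : Type*} (ρ : Var → Var)
    (g : ι → UserConstraint S (graphSig TG) Var) (α : Var → CT.Carrier) :
    (fun i => (renameFamily ρ g i).ground CT.toInterp α) =
      fun i => (g i).ground CT.toInterp (α ∘ ρ) :=
  funext fun i => (g i).ground_rename _ α ρ

/-- The values of a state after a transition, in terms of those before. -/
theorem sem_step {ρ : Var → Var} (hρ : Set.InjOn ρ (p.encode (S := S) ν).vars)
    {κ κ' : Type*} [Fintype κ] [Fintype κ'] {gV : κ → UserConstraint S (graphSig TG) Var}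
    {gE : κ' → UserConstraint S (graphSig TG) Var} {B : Store S Var} {V : Finset Var}
    (hV : ∀ x ∈ ((p.encode (S := S) ν).rename ρ).vars, x ∉ V)
    (hfresh : ∀ x ∈ ((p.encode (S := S) ν).rename ρ).vars, x ∉ ((p.encode (S := S) ν).rename ρ).headVars →
      x ∉ goalVars (Finset.univ.val.map gV + Finset.univ.val.map gE) ∧ x ∉ storeVars B)
    (γ : Var → CT.Carrier)
    (M : (p.R.V ⊕ κ) ⊕ (p.R.E ⊕ κ') → (TG.V ⊕ TG.E) × List CT.Carrier) :
    Sem CT.toInterp (glue (renameFamily ρ (rightFamily p ν)) gV gE)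
        (storeRename ρ (p.encode ν).bodyB + B) V γ M ↔
      StepRel CT p (Sem CT.toInterp (glue (renameFamily ρ (leftFamily p ν)) gV gE) B V γ) M := by
  constructor
  · rintro ⟨α, hα, hB, hM⟩
    rw [storeHolds_add, storeHolds_rename, storeHolds_bodyB] at hB
    -- The same valuation is read on the head and on the body; the body store relates the two
    -- readings.
    have hL : (fun i => (glue (renameFamily ρ (leftFamily p ν)) gV gE i).ground CT.toInterp α) =
        _ := (glue_ground α).trans (by rw [ground_renameFamily, ground_leftFamily])
    have hR := (funext hM).symm.trans ((glue_ground α).trans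
      (by rw [ground_renameFamily, ground_rightFamily ν fun k => (hB.1 k).1]))
    refine ⟨_, _, _, _, _, _, _, _, ⟨α, hα, hB.2, congrFun hL⟩, hR, ?_⟩
    · refine ⟨fun k => ?_, fun k => ?_, fun k => ?_, fun w hw => ?_⟩
      · simp only [rightV_onV]
      · simp only [rightE_onE]
      · obtain ⟨n, h1, h2⟩ := (hB.1 k).2
        refine ⟨n, ?_, ?_⟩
        · rw [leftDeg, if_pos (Set.mem_range_self k), h1]
        · rw [rightDeg, dif_pos (Set.mem_range_self k), choose_range_apply p.r.injV, h2]
      · rw [rightDeg, dif_neg hw]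
  · rintro ⟨x, d, y, x', d', y', m, m', ⟨α, hα, hB, hM⟩, rfl, hR⟩
    -- Only the values on new elements and copies matter. The default `0` falls on names whose
    -- values in `f` are never used.
    obtain ⟨f, hfv, hfd⟩ := ν.exists_valuation (CT.num 0)
      (fun i => match i with
        | .newV w => x' w
        | .newE e => y' e
        | .copyV k => x' (p.r.onV k)
        | _ => CT.num 0)
      (fun i => match i with
        | .copyV k => d' (p.r.onV k)
        | _ => CT.num 0)
    obtain ⟨α', hhead, hnew, hV', hG', hB'⟩ := CHRRule.exists_fresh_extension hρ hV hfresh α f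
    have hM' := funext hM
    rw [glue_ground, ground_renameFamily, ground_leftFamily] at hM'
    obtain ⟨hL, rfl, rfl⟩ := glue_inj hM'
    obtain ⟨rfl, rfl, rfl⟩ := graphVal_inj hL
    clear hM hM' hL
    have hcopy : ∀ k, (α' ∘ ρ) (ν.var (.copyV k)) = x' (p.r.onV k) := fun k =>
      (hnew _ (copyV_fresh ν k).1 (copyV_fresh ν k).2).trans (hfv _)
    have hdcopy : ∀ k, (α' ∘ ρ) (ν.dvar (.copyV k)) = d' (p.r.onV k) := fun k =>
      (hnew _ (copyV_dvar_fresh ν k).1 (copyV_dvar_fresh ν k).2).trans (hfd _)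
    have hleft : ∀ k, (α' ∘ ρ) (ν.var (.leftV (p.l.onV k))) = x' (p.r.onV k) := fun k =>
      (hhead _ (leftV_mem_headVars ν _)).trans (hR.node k).symm
    have hlr : ∀ k, (α' ∘ ρ) (ν.var (.leftV (p.l.onV k))) = (α' ∘ ρ) (ν.var (.copyV k)) :=
      fun k => (hleft k).trans (hcopy k).symm
    refine ⟨α', fun z hz => (hV' z hz).trans (hα z hz), ?_, fun i => ?_⟩
    · rw [storeHolds_add, storeHolds_rename, storeHolds_bodyB]
      refine ⟨fun k => ⟨hlr k, ?_⟩, (storeHolds_congr _ _ hB').2 hB⟩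
      obtain ⟨n, h1, h2⟩ := hR.deg k
      rw [leftDeg, if_pos (Set.mem_range_self k)] at h1
      exact ⟨n, (hhead _ (dvar_mem_headVars ν k)).trans h1, (hdcopy k).trans h2⟩
    · refine congrFun ((glue_ground α').trans ?_) i
      rw [ground_renameFamily, ground_rightFamily ν hlr]
      congr 1
      · congr 1
        · funext w
          by_cases hw : w ∈ Set.range p.r.onV
          · obtain ⟨k, rfl⟩ := hw
            rw [rightV_onV, hleft]
          · rw [rightV_of_notMem hw]
            exact (hnew _ (newV_fresh ν hw).1 (newV_fresh ν hw).2).trans (hfv _)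
        · funext w
          by_cases hw : w ∈ Set.range p.r.onV
          · rw [rightDeg, dif_pos hw, hdcopy, hw.choose_spec]
          · rw [rightDeg, dif_neg hw, hR.new w hw]
        · funext e
          by_cases he : e ∈ Set.range p.r.onE
          · obtain ⟨k, rfl⟩ := he
            rw [rightE_onE, hR.edge]
            exact hhead _ (leftE_mem_headVars ν _)
          · rw [rightE_of_notMem he]
            exact (hnew _ (newE_fresh ν he).1 (newE_fresh ν he).2).trans (hfv _)
      · funext j
        exact (gV j).ground_congr _ fun z hz => hG' z ⟨gV j, by simp, hz⟩
      · funext j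
        exact (gE j).ground_congr _ fun z hz => hG' z ⟨gE j, by simp, hz⟩

end RuleSemantics

/-! ### Transitions, admissible stores after a step, and the conclusion. -/

section Main

variable {S : BuiltinSig.{u}} {Var : Type v} {TG : FinGraph} {CT : ConstraintTheory.{u, w} S}

theorem map_univ_glue {A B κ κ' X : Type*} [Fintype A] [Fintype B] [Fintype κ] [Fintype κ']
    (f : A ⊕ B → X) (m : κ → X) (m' : κ' → X) :
    Finset.univ.val.map (glue f m m') =
      Finset.univ.val.map f + (Finset.univ.val.map m + Finset.univ.val.map m') := by
  have hf : f = Sum.elim (fun a => f (.inl a)) (fun b => f (.inr b)) := by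
    funext i; cases i <;> rfl
  rw [hf]
  simp only [glue, map_univ_sumElim, Sum.elim_inl, Sum.elim_inr]
  abel

/-- A goal splits into node constraints and edge constraints. -/
theorem exists_node_edge_families (G : Goal S (graphSig TG) Var) :
    ∃ (n n' : ℕ) (gV : Fin n → UserConstraint S (graphSig TG) Var)
      (gE : Fin n' → UserConstraint S (graphSig TG) Var),
      Finset.univ.val.map gV + Finset.univ.val.map gE = G ∧
        (∀ i, (gV i).sym.isLeft = true) ∧ ∀ i, ¬ (gE i).sym.isLeft = true := by
  obtain ⟨n, gV, hV⟩ := exists_family (G.filter fun c => c.sym.isLeft = true)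
  obtain ⟨n', gE, hE⟩ := exists_family (G.filter fun c => ¬ c.sym.isLeft = true)
  refine ⟨n, n', gV, gE, by rw [hV, hE, Multiset.filter_add_not], fun i => ?_, fun i => ?_⟩
  · have : gV i ∈ Finset.univ.val.map gV := Multiset.mem_map_of_mem _ (Finset.mem_univ i)
    rw [hV] at this
    exact (Multiset.mem_filter.1 this).2
  · have : gE i ∈ Finset.univ.val.map gE := Multiset.mem_map_of_mem _ (Finset.mem_univ i)
    rw [hE] at this
    exact (Multiset.mem_filter.1 this).2

/-- A predicate that tells nodes from edges lets an equality of goals be split into two, giving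
separate bijections for nodes and edges. -/
theorem map_univ_sum_filter {A B X : Type*} [Fintype A] [Fintype B] {f : A ⊕ B → X}
    {P : X → Prop} [DecidablePred P] (hA : ∀ a, P (f (.inl a))) (hB : ∀ b, ¬ P (f (.inr b))) :
    (Finset.univ.val.map f).filter P = Finset.univ.val.map (fun a => f (.inl a)) ∧
    (Finset.univ.val.map f).filter (¬ P ·) = Finset.univ.val.map (fun b => f (.inr b)) := by
  have hf : f = Sum.elim (fun a => f (.inl a)) (fun b => f (.inr b)) := by
    funext i; cases i <;> rfl
  have hA' : ∀ x ∈ Finset.univ.val.map (fun a => f (.inl a)), P x := by simpa using hA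
  have hB' : ∀ x ∈ Finset.univ.val.map (fun b => f (.inr b)), ¬ P x := by simpa using hB
  rw [hf]
  simp only [map_univ_sumElim, Multiset.filter_add, Sum.elim_inl, Sum.elim_inr]
  rw [Multiset.filter_eq_self.2 hA', Multiset.filter_eq_nil.2 hB', Multiset.filter_eq_self.2 hB',
    Multiset.filter_eq_nil.2 fun x hx => not_not.2 (hA' x hx), add_zero, zero_add]
  exact ⟨rfl, rfl⟩

/-- The graph encoded by a state can be indexed along any division of the goal into node and edge
constraints. -/
theorem EncodesGraph.exists_encodes {A B : Type} [Fintype A] [Fintype B]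
    {h : A ⊕ B → UserConstraint S (graphSig TG) Var} {D : Store S Var} {V : Finset Var}
    (hσ : EncodesGraph CT ⟨Finset.univ.val.map h, D, V⟩)
    (hA : ∀ a, (h (.inl a)).sym.isLeft = true) (hB : ∀ b, ¬ (h (.inr b)).sym.isLeft = true) :
    ∃ (G : TypedGraph TG) (iV : A ≃ G.V) (iE : B ≃ G.E), Encodes CT G fun M =>
      ∃ γ, Sem CT.toInterp h D V γ fun i => M (Sum.map iV iE i) := by
  obtain ⟨G, g, hg, hG⟩ := hσ
  obtain ⟨γ, α, _, _, hM⟩ := hG.1 (fun _ => CT.num 0) (fun _ => CT.num 0)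
  have hgV : ∀ v, (g (.inl v)).sym.isLeft = true := fun v => by
    have : (g (.inl v)).sym = .inl (G.type.onV v) := congrArg Prod.fst (hM (.inl v))
    rw [this]; rfl
  have hgE : ∀ e, ¬ (g (.inr e)).sym.isLeft = true := fun e => by
    have : (g (.inr e)).sym = .inr (G.type.onE e) := congrArg Prod.fst (hM (.inr e))
    rw [this]; simp
  have f₁ := map_univ_sum_filter (f := g) (P := fun c => c.sym.isLeft = true) hgV hgE
  have f₂ := map_univ_sum_filter (f := h) (P := fun c => c.sym.isLeft = true) hA hB
  obtain ⟨iV, hiV⟩ := exists_equiv_of_map_univ_eq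
    (f₂.1.symm.trans ((congrArg (Multiset.filter _) hg.symm).trans f₁.1))
  obtain ⟨iE, hiE⟩ := exists_equiv_of_map_univ_eq
    (f₂.2.symm.trans ((congrArg (Multiset.filter _) hg.symm).trans f₁.2))
  have hh : h = fun i => g (iV.sumCongr iE i) := by
    funext i
    cases i with
    | inl a => exact (hiV a).symm
    | inr b => exact (hiE b).symm
  refine ⟨G, iV, iE, ?_⟩
  convert hG using 4 with M
  rw [hh, sem_comp_equiv]
  have : (fun k => M (Sum.map iV iE ((iV.sumCongr iE).symm k))) = M := by
    funext k
    cases k <;> simp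
  rw [this]

theorem stepRel_exists {p : ProductionRule TG} {κ κ' X : Type*}
    {Q : X → ((p.L.V ⊕ κ) ⊕ (p.L.E ⊕ κ') → (TG.V ⊕ TG.E) × List CT.Carrier) → Prop}
    {M : (p.R.V ⊕ κ) ⊕ (p.R.E ⊕ κ') → (TG.V ⊕ TG.E) × List CT.Carrier} :
    StepRel CT p (fun M => ∃ γ, Q γ M) M ↔ ∃ γ, StepRel CT p (Q γ) M := by
  constructor
  · rintro ⟨x, d, y, x', d', y', m, m', ⟨γ, h⟩, h'⟩
    exact ⟨γ, x, d, y, x', d', y', m, m', h, h'⟩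
  · rintro ⟨γ, x, d, y, x', d', y', m, m', h, h'⟩
    exact ⟨x, d, y, x', d', y', m, m', ⟨γ, h⟩, h'⟩

/-- A constraint `x = t - c₁ + c₂` of the admissible form, for a term `t` that can denote an
integer. -/
theorem exists_degree_constraint {t : Term S Var}
    (ht : ∃ (α : Var → CT.Carrier) (n : ℤ), t.eval CT.toInterp α = CT.num n) (x : Var)
    (c₁ c₂ : ℤ) : ∃ b : Builtin S Var, (IsConstEq b ∨ IsOffsetEq b) ∧
      ∀ α, b.Holds CT.toInterp α ↔
        ∃ n : ℤ, t.eval CT.toInterp α = CT.num n ∧ α x = CT.num (n - c₁ + c₂) := by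
  cases t with
  | var y =>
    -- The admissible form adds before it subtracts, hence the exchanged constants.
    refine ⟨_, .inr ⟨x, y, c₂, c₁, rfl⟩, fun α => ?_⟩
    rw [holds_offset]
    refine exists_congr fun n => and_congr Iff.rfl ?_
    rw [show n + c₂ - c₁ = n - c₁ + c₂ by ring]
  | num n =>
    refine ⟨_, .inl ⟨x, .num (n - c₁ + c₂), .inl ⟨_, rfl⟩, rfl⟩, fun α => ⟨fun h => ⟨n, rfl, h⟩, ?_⟩⟩
    rintro ⟨m, hm, h⟩
    obtain rfl : n = m := CT.num_inj hm
    exact h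
  | app f args =>
    obtain ⟨α, n, h⟩ := ht
    exact absurd h (CT.fn_ne_num _ _ _)

/-- The values after a transition are those of a state whose store has the admissible form, if this
holds for the values before. -/
theorem exists_degreeStore_step [Infinite Var] (p : ProductionRule TG) {κ κ' : Type}
    [Fintype κ] [Fintype κ']
    {h : (p.L.V ⊕ κ) ⊕ (p.L.E ⊕ κ') → UserConstraint S (graphSig TG) Var} {B : Store S Var}
    {V : Finset Var} (hB : ∀ b ∈ B, IsConstEq b ∨ IsOffsetEq b)
    (hL : ∀ γ M, Sem CT.toInterp h B V γ M → ∃ x d y m m', M = glue (graphVal p.L x d y) m m')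
    (hsat : ∃ γ M, Sem CT.toInterp h B V γ M ∧ ∀ v, ∃ s c, ∃ n : ℤ,
      M (.inl (.inl v)) = (s, [c, CT.num n])) :
    ∃ (h' : (p.R.V ⊕ κ) ⊕ (p.R.E ⊕ κ') → UserConstraint S (graphSig TG) Var) (C : Store S Var),
      (∀ b ∈ C, IsConstEq b ∨ IsOffsetEq b) ∧
        ∀ γ M, Sem CT.toInterp h' C V γ M ↔ StepRel CT p (Sem CT.toInterp h B V γ) M := by
  classical
  obtain ⟨γ₀, M₀, hM₀, hn₀⟩ := hsat
  obtain ⟨x₀, d₀, y₀, m₀, m₀', rfl⟩ := hL _ _ hM₀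
  obtain ⟨α₀, _, hα₀, hα₀'⟩ := hM₀
  choose sV dV hV using fun v => UserConstraint.exists_node_args (CT := CT)
    (congrArg Prod.fst (hα₀' (.inl (.inl v))))
  choose sE tE uE hE using fun e => UserConstraint.exists_edge_args (CT := CT)
    (congrArg Prod.fst (hα₀' (.inr (.inl e))))
  have hval : ∀ {α x d y m m'}, (∀ i, (h i).ground CT.toInterp α =
      glue (graphVal p.L x d y) m m' i) → (∀ v, (sV v).eval CT.toInterp α = x v) ∧
      (∀ v, (dV v).eval CT.toInterp α = d v) ∧ ∀ e, (sE e).eval CT.toInterp α = y e := by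
    intro α x d y m m' hα
    have h1 : ∀ v, (sV v).eval CT.toInterp α = x v ∧ (dV v).eval CT.toInterp α = d v := fun v => by
      have := hα (.inl (.inl v))
      rw [hV] at this
      simp only [glue, graphVal, Sum.elim_inl, Prod.mk.injEq, List.cons.injEq] at this
      exact ⟨this.2.1, this.2.2.1⟩
    refine ⟨fun v => (h1 v).1, fun v => (h1 v).2, fun e => ?_⟩
    have := hα (.inr (.inl e))
    rw [hE] at this
    simp only [glue, graphVal, Sum.elim_inr, Sum.elim_inl, Prod.mk.injEq, List.cons.injEq] at this
    exact this.2.1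
  -- Fresh names for the identifiers of new nodes and edges, and for the updated degrees of
  -- preserved nodes.
  obtain ⟨z, hz, hzF⟩ := exists_fresh (Var := Var) ((p.R.V ⊕ p.R.E) ⊕ p.K.V)
    (((goalVars_finite (Finset.univ.val.map h)).union (storeVars_finite B)).union V.finite_toSet)
  simp only [Set.mem_union, not_or, Finset.mem_coe] at hzF
  -- A degree term that can denote an integer is a variable or a numeral, so its update is an
  -- admissible constraint.
  have hint : ∀ v, ∃ (α : Var → CT.Carrier) (n : ℤ), (dV v).eval CT.toInterp α = CT.num n := by
    intro v
    obtain ⟨s, c, n, hn⟩ := hn₀ v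
    rw [← hα₀', hV] at hn
    simp only [Prod.mk.injEq, List.cons.injEq] at hn
    exact ⟨α₀, n, hn.2.2.1⟩
  choose q hq hq' using fun k => exists_degree_constraint (hint (p.l.onV k)) (z (.inr k))
    (p.L.deg (p.l.onV k)) (p.R.deg (p.r.onV k))
  -- Preserved elements keep their old identifier terms, so no equation between a node and its copy
  -- enters the store.
  let idV : p.R.V → Term S Var := fun w =>
    if hw : w ∈ Set.range p.r.onV then sV (p.l.onV hw.choose) else .var (z (.inl (.inl w)))
  let idE : p.R.E → Term S Var := fun e =>
    if he : e ∈ Set.range p.r.onE then sE (p.l.onE he.choose) else .var (z (.inl (.inr e)))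
  let dR : p.R.V → Term S Var := fun w =>
    if hw : w ∈ Set.range p.r.onV then .var (z (.inr hw.choose)) else .num (p.R.deg w)
  have hidV : ∀ k, idV (p.r.onV k) = sV (p.l.onV k) := fun k => by
    simp only [idV, Set.mem_range_self, dif_pos, choose_range_apply p.r.injV]
  have hidE : ∀ k, idE (p.r.onE k) = sE (p.l.onE k) := fun k => by
    simp only [idE, Set.mem_range_self, dif_pos, choose_range_apply p.r.injE]
  have hdR : ∀ k, dR (p.r.onV k) = .var (z (.inr k)) := fun k => by
    simp only [dR, Set.mem_range_self, dif_pos, choose_range_apply p.r.injV]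
  let f : p.R.V ⊕ p.R.E → UserConstraint S (graphSig TG) Var :=
    Sum.elim (fun w => ⟨.inl (p.R.type.onV w), ![idV w, dR w]⟩)
      fun e => ⟨.inr (p.R.type.onE e), ![idE e, idV (p.R.src e), idV (p.R.tgt e)]⟩
  have hf : ∀ α, (fun i => (f i).ground CT.toInterp α) =
      graphVal p.R (fun w => (idV w).eval CT.toInterp α) (fun w => (dR w).eval CT.toInterp α)
        fun e => (idE e).eval CT.toInterp α := fun α => by
    funext i
    cases i <;> rfl
  have hC : ∀ α, StoreHolds CT.toInterp α (B + Finset.univ.val.map q) ↔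
      StoreHolds CT.toInterp α B ∧ ∀ k, ∃ n : ℤ, (dV (p.l.onV k)).eval CT.toInterp α = CT.num n ∧
        α (z (.inr k)) = CT.num (n - p.L.deg (p.l.onV k) + p.R.deg (p.r.onV k)) := fun α => by
    simp only [storeHolds_add, ← hq']
    simp [StoreHolds]
  refine ⟨glue f (fun j => h (.inl (.inr j))) (fun j => h (.inr (.inr j))),
    B + Finset.univ.val.map q, fun b hb => ?_, fun γ M => ⟨?_, ?_⟩⟩
  · obtain hb | hb := Multiset.mem_add.1 hb
    · exact hB b hb
    · obtain ⟨k, _, rfl⟩ := Multiset.mem_map.1 hb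
      exact hq k
  · rintro ⟨α, hα, hst, hM⟩
    rw [hC] at hst
    have hS : Sem CT.toInterp h B V γ fun i => (h i).ground CT.toInterp α :=
      ⟨α, hα, hst.1, fun _ => rfl⟩
    obtain ⟨x, d, y, m, m', hm⟩ := hL _ _ hS
    obtain ⟨h1, h2, h3⟩ := hval (congrFun hm)
    refine ⟨x, d, y, fun w => (idV w).eval CT.toInterp α, fun w => (dR w).eval CT.toInterp α,
      fun e => (idE e).eval CT.toInterp α, m, m', hm ▸ hS,
      (funext hM).symm.trans ((glue_ground α).trans ?_), ?_⟩
    · rw [hf]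
      congr 1
      · exact funext fun j => congrFun hm (.inl (.inr j))
      · exact funext fun j => congrFun hm (.inr (.inr j))
    · refine ⟨fun k => ?_, fun k => ?_, fun k => ?_, fun w hw => ?_⟩
      · simp only [hidV, h1]
      · simp only [hidE, h3]
      · simp only [hdR, ← h2]
        exact hst.2 k
      · simp only [dR, dif_neg hw, Term.eval]
  · rintro ⟨x, d, y, x', d', y', m, m', ⟨α, hα, hst, hM⟩, rfl, hR⟩
    obtain ⟨h1, h2, h3⟩ := hval hM
    -- Changing only fresh variables preserves the old goal, store and globals, while giving the new
    -- elements and degrees their prescribed values.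
    let α' : Var → CT.Carrier :=
      Function.extend z (Sum.elim (Sum.elim x' y') fun k => d' (p.r.onV k)) α
    have hz' : ∀ i, α' (z i) = Sum.elim (Sum.elim x' y') (fun k => d' (p.r.onV k)) i :=
      fun i => hz.extend_apply _ _ i
    have hne : ∀ a, (∀ i, z i ≠ a) → α' a = α a := fun a ha =>
      Function.extend_apply' _ _ _ fun ⟨i, hi⟩ => ha i hi
    have hM' : ∀ i, (h i).ground CT.toInterp α' = glue (graphVal p.L x d y) m m' i := fun i => by
      rw [← hM i]
      exact ground_congr_of_goalVars _ rfl
        (fun a ha => hne a fun j e => (hzF j).1.1 (e ▸ ha)) i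
    obtain ⟨h1, h2, h3⟩ := hval hM'
    refine ⟨α', fun a ha => (hne a fun j e => (hzF j).2 (e ▸ ha)).trans (hα a ha), ?_,
      congrFun ((glue_ground α').trans ?_)⟩
    · rw [hC]
      refine ⟨(storeHolds_congr _ _ fun a ha => hne a fun j e => (hzF j).1.2 (e ▸ ha)).2 hst,
        fun k => ?_⟩
      rw [h2, hz']
      exact hR.deg k
    · rw [hf]
      congr 1
      · congr 1
        · funext w
          by_cases hw : w ∈ Set.range p.r.onV
          · obtain ⟨k, rfl⟩ := hw
            rw [hidV, h1, hR.node]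
          · simp only [idV, dif_neg hw, Term.eval, hz', Sum.elim_inl]
        · funext w
          by_cases hw : w ∈ Set.range p.r.onV
          · obtain ⟨k, rfl⟩ := hw
            simp only [hdR, Term.eval, hz', Sum.elim_inr]
          · simp only [dR, dif_neg hw, Term.eval, hR.new w hw]
        · funext e
          by_cases he : e ∈ Set.range p.r.onE
          · obtain ⟨k, rfl⟩ := he
            rw [hidE, h3, hR.edge]
          · simp only [idE, dif_neg he, Term.eval, hz', Sum.elim_inl, Sum.elim_inr]
      · exact funext fun j => hM' (.inl (.inr j))
      · exact funext fun j => hM' (.inr (.inr j))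

theorem leftFamily_sym {p : ProductionRule TG} (ν : Naming (RuleItem p) Var) :
    (∀ v, (leftFamily (S := S) p ν (.inl v)).sym.isLeft = true) ∧
      ∀ e, ¬ (leftFamily (S := S) p ν (.inr e)).sym.isLeft = true := by
  refine ⟨fun v => ?_, fun e => Bool.false_ne_true⟩
  simp only [leftFamily, Sum.elim_inl]
  split_ifs <;> rfl

/-- Transitions preserve the encoding of graphs, and the existence of representatives with a store
of the form `X = c`, `X = Y + c₁ - c₂`. -/
theorem Transition.encodesGraph [Infinite Var] {T : GTS}
    {ν : ∀ p : ProductionRule T.TG, Naming (RuleItem p) Var}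
    {σ τ : CHRState S (graphSig T.TG) Var} (h : Transition CT (T.program ν) σ τ)
    (hσ : HasDegreeStore σ) (hG : EncodesGraph CT σ) :
    EncodesGraph CT τ ∧ ∃ τ', HasDegreeStore τ' ∧ StateEquiv CT τ τ' := by
  obtain ⟨_, ⟨p, _, rfl⟩, ρ, hρ, _, G, B, V, rfl, hV, hfresh, hleft, hright⟩ := h
  obtain ⟨n, n', gV, gE, rfl, hgV, hgE⟩ := exists_node_edge_families G
  have hl : Finset.univ.val.map (glue (renameFamily ρ (leftFamily p (ν p))) gV gE) =
      ((p.encode (ν p)).rename ρ).kept + ((p.encode (ν p)).rename ρ).removed +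
        (Finset.univ.val.map gV + Finset.univ.val.map gE) := by
    rw [map_univ_glue, map_renameFamily, map_leftFamily]
    simp [CHRRule.rename, ProductionRule.encode, goalRename]
  have hr : Finset.univ.val.map (glue (renameFamily ρ (rightFamily p (ν p))) gV gE) =
      ((p.encode (ν p)).rename ρ).kept + ((p.encode (ν p)).rename ρ).bodyU +
        (Finset.univ.val.map gV + Finset.univ.val.map gE) := by
    rw [map_univ_glue, map_renameFamily, map_rightFamily]
    simp [CHRRule.rename, ProductionRule.encode, goalRename]
  have hg : ((p.encode (S := S) (ν p)).rename ρ).guard = 0 := rfl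
  have hb : ((p.encode (S := S) (ν p)).rename ρ).bodyB = storeRename ρ (p.encode (ν p)).bodyB := rfl
  rw [← hl, hg, zero_add] at hleft
  rw [← hr, hg, hb, zero_add] at hright
  have hstep := sem_step (CT := CT) (ν p) hρ hV hfresh
  have hform : ∀ γ M, Sem CT.toInterp (glue (renameFamily ρ (leftFamily p (ν p))) gV gE) B V γ M →
      ∃ x d y m m', M = glue (graphVal p.L x d y) m m' ∧
        ∀ v, v ∉ Set.range p.l.onV → d v = CT.num (p.L.deg v) := by
    rintro γ M ⟨α, _, _, hM⟩
    refine ⟨_, _, _, _, _, (funext hM).symm.trans ((glue_ground α).trans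
      (by rw [ground_renameFamily, ground_leftFamily])), fun v hv => ?_⟩
    rw [leftDeg, if_neg hv]
  obtain ⟨Γ, iV, iE, hΓ⟩ := (hG.congr hleft).exists_encodes
    (by
      rintro (v | j)
      · exact (leftFamily_sym (S := S) (ν p)).1 v
      · exact hgV j)
    (by
      rintro (e | j)
      · exact (leftFamily_sym (S := S) (ν p)).2 e
      · exact hgE j)
  constructor
  · obtain ⟨Γ', φ, hΓ'⟩ := Encodes.step p (Q := fun M => ∃ γ, Sem CT.toInterp
      (glue (renameFamily ρ (leftFamily p (ν p))) gV gE) B V γ M)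
      (fun M hM => hform _ M hM.choose_spec) iV iE hΓ
    refine EncodesGraph.congr hright.symm ⟨Γ', fun i => glue (renameFamily ρ (rightFamily p (ν p)))
      gV gE (φ i), map_univ_comp_equiv φ _, ?_⟩
    simp only [sem_comp_equiv, hstep]
    simpa only [stepRel_exists] using hΓ'
  · obtain ⟨γ₀, hS₀⟩ := hΓ.1 (fun _ => CT.num 0) (fun _ => CT.num 0)
    -- The matched state need not have an admissible store, but `σ` does. Its goal is indexed in the
    -- same way and has the same values, so the step is redone from `σ`.
    obtain ⟨h, hh, e⟩ := hleft.symm.semEq.exists_family ⟨_, hS₀.choose_spec.2.1⟩ _ rfl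
    dsimp only at e
    obtain ⟨h', C, hC, hC'⟩ := exists_degreeStore_step (CT := CT) p hσ
      (fun γ M hM => by
        obtain ⟨x, d, y, m, m', hM, _⟩ := hform γ M ((e γ M).2 hM)
        exact ⟨x, d, y, m, m', hM⟩)
      ⟨γ₀, _, (e _ _).1 hS₀, fun v => ⟨_, _, _, rfl⟩⟩
    refine ⟨⟨Finset.univ.val.map h', C, σ.globals⟩, hC, hright.trans (.of_sem fun γ M => ?_)⟩
    rw [hstep, hC']
    have : Sem CT.toInterp (glue (renameFamily ρ (leftFamily p (ν p))) gV gE) B V γ =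
        Sem CT.toInterp h σ.store σ.globals γ := funext fun M => propext (e γ M)
    rw [this]

end Main

theorem mainTheorem3 {S : BuiltinSig.{u}} (CT : ConstraintTheory.{u, w} S) {Var : Type v}
    [Infinite Var] (T : GTS) (ν : ∀ p : ProductionRule T.TG, Naming (RuleItem p) Var) :
    (∀ σ₀ σ₁ : CHRState S (graphSig T.TG) Var, HasDegreeStore σ₀ → HasDegreeStore σ₁ →
        StateEquiv CT σ₀ σ₁ → GraphInvariantAt CT σ₀ → GraphInvariantAt CT σ₁) ∧
      (∀ σ₀ σ₁ : CHRState S (graphSig T.TG) Var, HasDegreeStore σ₁ →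
        Transition CT (T.program ν) σ₀ σ₁ → GraphInvariantAt CT σ₀ → GraphInvariantAt CT σ₁) ∧
      IsProgramInvariant CT (T.program ν) (GraphInvariant CT) := by
  refine ⟨fun σ₀ σ₁ _ h₁ h h₀ => (h₀.encodesGraph.congr h).graphInvariantAt h₁,
    fun σ₀ σ₁ h₁ h h₀ => (h.encodesGraph h₀.1 h₀.encodesGraph).1.graphInvariantAt h₁, ?_⟩
  rintro σ₀ σ₁ (h | h) ⟨σ, hσ, hσ'⟩
  -- Transitions are defined up to equivalence, so the admissible representative of the initial
  -- class makes the same step.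
  · have h' : Transition CT (T.program ν) σ σ₁ := by
      obtain ⟨r, hr, ρ, hρ, c, G, B, V, hc, hV, hf, h₀, h₁⟩ := h
      exact ⟨r, hr, ρ, hρ, c, G, B, V, hc, hV, hf, hσ.symm.trans h₀, h₁⟩
    obtain ⟨h₁, τ, hτ, hτ'⟩ := h'.encodesGraph hσ'.1 hσ'.encodesGraph
    exact ⟨τ, hτ', (h₁.congr hτ').graphInvariantAt hτ⟩
  · exact ⟨σ, h.symm.trans hσ, hσ'⟩
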